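/- Let $Y_1,Y_2,\dots$ be independent real random variables that all come from one of the following five non-Gaussian natural exponential families with quadratic variance function $V(t)=\nu_0+\nu_1t+\nu_2t^2$, where $\theta_i=E(Y_i)$ and $\operatorname{Var}(Y_i)=V(\theta_i)/\tau_i$, and assume the conditions listed for that family: 1. Binomial: $Y_i\sim\mathrm{Bin}(n_i,p_i)/n_i$, $\tau_i=n_i$, $\theta_i=p_i\in[0,1]$, $(\nu_0,\nu_1,\nu_2)=(0,1,-1)$; $n_i\ge2$ for all $i$. 2. Poisson: $Y_i\sim\mathrm{Poisson}(\tau_i\theta_i)/\tau_i$, $(\nu_0,\nu_1,\nu_2)=(0,1,0)$; $\inf_i\tau_i>0$, $\inf_i(\tau_i\theta_i)>0$ and $\sum_{i\le p}\theta_i^3=O(p)$. 3. Negative binomial: $Y_i\sim\mathrm{NBin}(n_i,p_i)/n_i$ with real $n_i>0$ and $0<p_i<1$, where $\mathrm{NBin}(n,p)$ has mass $\frac{\Gamma(n+k)}{\Gamma(n)\,k!}(1-p)^np^k$ at $k=0,1,2,\dots$; $\tau_i=n_i$, $\theta_i=\frac{p_i}{1-p_i}$, $(\nu_0,\nu_1,\nu_2)=(0,1,1)$;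 $\inf_i(n_ip_i)>0$ and $\sum_{i\le p}\bigl(\frac{p_i}{1-p_i}\bigr)^4=O(p)$. 4. Gamma: $Y_i\sim\Gamma(\tau_i\alpha,\lambda_i)/\tau_i$ (shape $\tau_i\alpha$, scale $\lambda_i>0$) with fixed $\alpha>0$; $\theta_i=\alpha\lambda_i$, $(\nu_0,\nu_1,\nu_2)=(0,0,1/\alpha)$; $\inf_i\tau_i>0$ and $\sum_{i\le p}\lambda_i^4=O(p)$. 5. Generalized hyperbolic secant: $Y_i\sim\mathrm{GHS}(\tau_i\alpha,\lambda_i)/\tau_i$ with fixed $\alpha>0$ and $\lambda_i\in\mathbb R$, where $\mathrm{GHS}(r,\lambda)$ has density $\frac{2^{r-2}}{\pi\Gamma(r)}\bigl|\Gamma\bigl(\tfrac{r+\mathrm{i}x}{2}\bigr)\bigr|^2(1+\lambda^2)^{-r/2}e^{x\arctan\lambda}$ on $\mathbb R$ (here $\mathrm{i}^2=-1$); $\theta_i=\alpha\lambda_i$, $(\nu_0,\nu_1,\nu_2)=(\alpha,0,1/\alpha)$; $\inf_i\tau_i>0$ and $\sum_{i\le p}\lambda_i^4=O(p)$. For $0\le\gamma\le\infty$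 and $\mu\in\mathbb R$ let $$\hat\theta_i^{\gamma,\mu}=\frac{\tau_i}{\tau_i+\gamma}Y_i+\frac{\gamma}{\tau_i+\gamma}\mu,\qquad l_p(\gamma,\mu)=\frac1p\sum_{i=1}^p\bigl(\hat\theta_i^{\gamma,\mu}-\theta_i\bigr)^2,$$ $$\operatorname{URE}^P(\gamma,\mu)=\frac1p\sum_{i=1}^p\Bigl[\frac{\gamma^2}{(\tau_i+\gamma)^2}(Y_i-\mu)^2+\frac{\tau_i-\gamma}{\tau_i+\gamma}\cdot\frac{V(Y_i)}{\tau_i+\nu_2}\Bigr],$$ the coefficients at $\gamma=\infty$ being the limits as $\gamma\to\infty$. Then, for every set $\Theta\subseteq\mathbb R$ (for example the set of allowable means, or $\mathbb R$ itself), $$\sup\Bigl\{\bigl|\operatorname{URE}^P(\gamma,\mu)-l_p(\gamma,\mu)\bigr| : 0\le\gamma\le\infty,\ |\mu|\le\max_{1\le i\le p}|Y_i|,\ \mu\in\Theta\Bigr\}\longrightarrow0\qquad\text{as }p\to\infty,$$ in $L^1$ and in probability, where the supremum over an empty set is $0$. -/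

import Mathlib

open MeasureTheory ProbabilityTheory Filter Topology
open scoped ENNReal

/-- The negative-binomial distribution with convolution parameter `r > 0` and parameter
`q ∈ (0, 1)`: the mass at `k` is `Γ(r + k) / (Γ(r) k!) * (1 - q) ^ r * q ^ k`. For integer `r` it is
the number of successes (of probability `q`) before the `r`-th failure; its mean is
`r * q / (1 - q)`. -/
noncomputable def negBinomialMeasure (r q : ℝ) : Measure ℕ :=
  Measure.sum fun k : ℕ =>
    ENNReal.ofReal (Real.Gamma (r + k) / (Real.Gamma r * (k.factorial : ℝ)) *
      (1 - q) ^ r * q ^ k) • Measure.dirac k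

/-- The density of the generalized hyperbolic secant distribution with convolution parameter `r > 0`
and parameter `l` (mean `r * l`, variance `r * (1 + l ^ 2)`). For `r = 1`, `l = 0` it is the
hyperbolic secant density `1 / (2 cosh (π x / 2))`; in general it is the exponential tilt, with
natural parameter `arctan l`, of the `r`-fold convolution power of that density. -/
noncomputable def ghsPDFReal (r l x : ℝ) : ℝ :=
  (2 : ℝ) ^ (r - 2) / (Real.pi * Real.Gamma r) *
    ‖Complex.Gamma (((r : ℂ) + (x : ℂ) * Complex.I) / 2)‖ ^ 2 *
    (1 + l ^ 2) ^ (-r / 2) * Real.exp (Real.arctan l * x)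

/-- The generalized hyperbolic secant distribution `GHS(r, l)`. -/
noncomputable def ghsMeasure (r l : ℝ) : Measure ℝ :=
  volume.withDensity fun x => ENNReal.ofReal (ghsPDFReal r l x)

/-- `NEFQVFModel P Y ν₀ ν₁ ν₂ τ θ`: the sequence `Y 0, Y 1, …` comes from one of the five
non-Gaussian natural exponential families with quadratic variance function
`V(t) = ν₀ + ν₁ t + ν₂ t ^ 2`, the observation `Y i` having mean `θ i` and convolution parameter
`τ i` (so its variance is `V(θ i) / τ i`), and the growth conditions belonging to that family
hold. Independence is not part of this predicate. -/
inductive NEFQVFModel {Ω : Type*} [MeasurableSpace Ω] (P : Measure Ω) (Y : ℕ → Ω → ℝ) :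
    (ν₀ ν₁ ν₂ : ℝ) → (τ θ : ℕ → ℝ) → Prop
  /-- `Y i ∼ Bin(n i, q i) / n i`. -/
  | binomial (n : ℕ → ℕ) (q : ℕ → unitInterval)
      (law : ∀ i, HasLaw (Y i)
        ((ProbabilityTheory.binomial (n i) (q i)).map fun k : ℕ => (k : ℝ) / (n i : ℝ)) P)
      (hn : ∀ i, 2 ≤ n i) :
      NEFQVFModel P Y 0 1 (-1) (fun i => (n i : ℝ)) (fun i => (q i : ℝ))
  /-- `Y i ∼ Poisson(τ i * θ i) / τ i`. -/
  | poisson (τ θ : ℕ → ℝ)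
      (law : ∀ i, HasLaw (Y i)
        ((poissonMeasure (τ i * θ i).toNNReal).map fun k : ℕ => (k : ℝ) / τ i) P)
      (hτ : ∃ c : ℝ, 0 < c ∧ ∀ i, c ≤ τ i)
      (hτθ : ∃ c : ℝ, 0 < c ∧ ∀ i, c ≤ τ i * θ i)
      (hθ : (fun p : ℕ => ∑ i ∈ Finset.range p, θ i ^ 3) =O[atTop] fun p : ℕ => (p : ℝ)) :
      NEFQVFModel P Y 0 1 0 τ θ
  /-- `Y i ∼ NBin(n i, q i) / n i`. -/
  | negBinomial (n q : ℕ → ℝ) (n_pos : ∀ i, 0 < n i) (q_mem : ∀ i, q i ∈ Set.Ioo (0 : ℝ) 1)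
      (law : ∀ i, HasLaw (Y i)
        ((negBinomialMeasure (n i) (q i)).map fun k : ℕ => (k : ℝ) / n i) P)
      (hnq : ∃ c : ℝ, 0 < c ∧ ∀ i, c ≤ n i * q i)
      (hq : (fun p : ℕ => ∑ i ∈ Finset.range p, (q i / (1 - q i)) ^ 4)
        =O[atTop] fun p : ℕ => (p : ℝ)) :
      NEFQVFModel P Y 0 1 1 n (fun i => q i / (1 - q i))
  /-- `Y i ∼ Γ(τ i * α, l i) / τ i`, with shape `τ i * α` and scale `l i`
  (`gammaMeasure` takes the shape and the rate). -/
  | gamma (α : ℝ) (τ l : ℕ → ℝ) (α_pos : 0 < α) (l_pos : ∀ i, 0 < l i)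
      (law : ∀ i, HasLaw (Y i)
        ((gammaMeasure (τ i * α) (1 / l i)).map fun x : ℝ => x / τ i) P)
      (hτ : ∃ c : ℝ, 0 < c ∧ ∀ i, c ≤ τ i)
      (hl : (fun p : ℕ => ∑ i ∈ Finset.range p, l i ^ 4) =O[atTop] fun p : ℕ => (p : ℝ)) :
      NEFQVFModel P Y 0 0 (1 / α) τ (fun i => α * l i)
  /-- `Y i ∼ GHS(τ i * α, l i) / τ i`. -/
  | ghs (α : ℝ) (τ l : ℕ → ℝ) (α_pos : 0 < α)
      (law : ∀ i, HasLaw (Y i) ((ghsMeasure (τ i * α) (l i)).map fun x : ℝ => x / τ i) P)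
      (hτ : ∃ c : ℝ, 0 < c ∧ ∀ i, c ≤ τ i)
      (hl : (fun p : ℕ => ∑ i ∈ Finset.range p, l i ^ 4) =O[atTop] fun p : ℕ => (p : ℝ)) :
      NEFQVFModel P Y α 0 (1 / α) τ (fun i => α * l i)

/-- The shrinkage weight `γ / (t + γ)`, extended to `γ = ∞` by its limit `1`. -/
noncomputable def shrinkWeight (t : ℝ) (γ : ℝ≥0∞) : ℝ :=
  if γ = ∞ then 1 else γ.toReal / (t + γ.toReal)

/-- The conjugate-form estimator `τ / (τ + γ) * Y + γ / (τ + γ) * μ` of the `i`-th mean. -/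
noncomputable def conjEstimator (τ y : ℕ → ℝ) (γ : ℝ≥0∞) (μ : ℝ) (i : ℕ) : ℝ :=
  (1 - shrinkWeight (τ i) γ) * y i + shrinkWeight (τ i) γ * μ

/-- The average squared-error loss of an estimate `est` of `θ` based on the first `p`
coordinates. -/
noncomputable def sqLoss (p : ℕ) (θ est : ℕ → ℝ) : ℝ :=
  1 / (p : ℝ) * ∑ i ∈ Finset.range p, (est i - θ i) ^ 2

/-- The parametric unbiased risk estimate `URE^P(γ, μ)` based on the first `p` observations, for
the variance function `V(t) = ν₀ + ν₁ t + ν₂ t ^ 2`. With `b = γ / (τ + γ)` the factor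
`(τ - γ) / (τ + γ)` is `1 - 2 b`. -/
noncomputable def parametricURE (ν₀ ν₁ ν₂ : ℝ) (τ : ℕ → ℝ) (p : ℕ) (y : ℕ → ℝ)
    (γ : ℝ≥0∞) (μ : ℝ) : ℝ :=
  1 / (p : ℝ) * ∑ i ∈ Finset.range p,
    (shrinkWeight (τ i) γ ^ 2 * (y i - μ) ^ 2 +
      (1 - 2 * shrinkWeight (τ i) γ) * ((ν₀ + ν₁ * y i + ν₂ * y i ^ 2) / (τ i + ν₂)))

/-- The supremum of `|URE^P(γ, μ) - l_p(θ, θ̂^{γ, μ})|` over all `γ ∈ [0, ∞]` and all `μ ∈ Θ` with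
`|μ| ≤ max_{i < p} |y i|`, as an extended nonnegative number. -/
noncomputable def supDiscrepancy (ν₀ ν₁ ν₂ : ℝ) (τ θ : ℕ → ℝ) (Θ : Set ℝ) (p : ℕ)
    (y : ℕ → ℝ) : ℝ≥0∞ :=
  ⨆ (γ : ℝ≥0∞) (μ : ℝ) (_ : μ ∈ Θ ∧ |μ| ≤ ⨆ i : Fin p, |y i|),
    ENNReal.ofReal
      |parametricURE ν₀ ν₁ ν₂ τ p y γ μ - sqLoss p θ (conjEstimator τ y γ μ)|

/-! With `b i = γ / (τ i + γ)`, `Z i = Y i - θ i` and the variance error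
`A i = V(Y i) / (τ i + ν₂) - Z i ^ 2`, the difference between the risk estimate and the loss is
`(1 / p) * (∑ A - 2 ∑ b A + 2 ∑ b Z θ - 2 μ ∑ b Z)`. For a quadratic variance function `A i` has
mean zero, so every sum is a weighted sum of independent centred variables.

The weights `b i` lie in `[0, 1]` and decrease in `τ i`. After sorting the first `p` coordinates by
`τ`, Abel summation bounds every weighted sum, uniformly in `γ`, by a running maximum of partial
sums (`abs_sum_shrinkWeight_le`), and Doob's `L²` inequality (`integral_sq_absRunMax_le`, proved
pathwise) bounds the second moment of that maximum by a sum of variances, which is `O(p)`. The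
factor `|μ| ≤ max |Y i|` satisfies `E max (Y i) ^ 2 = O(p ^ (2 / 3))`, from `∑ |θ i| ^ 3 = O(p)` and
`∑ E (Z i) ^ 4 = O(p)` (`sq_iSup_abs_le`). Splitting products at the scale `s = p ^ (1 / 6)` gives
`E sup = O(p ^ (-1 / 6))` (`lintegral_supDiscrepancy_le`, `tendsto_expectedBound`).

What remains are the first four moments of the families (`HasQVFMoments`). Poisson and negative
binomial weights satisfy `(k + 1) w (k + 1) = (a + b k) w k`, which yields the factorial moments;
gamma moments come from the functional equation of `Γ`, and binomial proportions are bounded. For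
the generalized hyperbolic secant distribution the function
`z ^ k Γ((r + 1 + i z) / 2) Γ((r + 1 - i z) / 2) exp (z arctan l)` is integrated along the lines
`Im z = ± 1`: both integrands are polynomials times the density, so that the contour shift gives
linear relations that determine the moments successively (`integral_ghsKernel_mul_im`). The decay of
`Γ` needed for the shift follows from the monotonicity of `|Γ(σ + i t)| / Γ(σ)` in `σ` and the
reflection formula at `σ = 1 / 2` (`exists_norm_Gamma_le`). Normalization of the density is not
needed separately, since it is part of the assumption on the law. -/

/-! ### Running maxima of partial sums -/

/-- The running maximum `max (0, x 0, x 0 + x 1, …)` of the first `n + 1` partial sums of `x`,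
the empty sum included. -/
noncomputable def runMax (x : ℕ → ℝ) : ℕ → ℝ
  | 0 => 0
  | n + 1 => max (runMax x n) (∑ j ∈ Finset.range (n + 1), x j)

lemma runMax_mono (x : ℕ → ℝ) : Monotone (runMax x) :=
  monotone_nat_of_le_succ fun _ => le_max_left _ _

lemma runMax_nonneg (x : ℕ → ℝ) (n : ℕ) : 0 ≤ runMax x n :=
  runMax_mono x (Nat.zero_le n)

lemma sum_range_le_runMax (x : ℕ → ℝ) {k n : ℕ} (h : k ≤ n) :
    ∑ j ∈ Finset.range k, x j ≤ runMax x n := by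
  refine le_trans ?_ (runMax_mono x h)
  cases k with
  | zero => simp [runMax]
  | succ k => exact le_max_right _ _

lemma runMax_congr {x y : ℕ → ℝ} {n : ℕ} (h : ∀ j < n, x j = y j) : runMax x n = runMax y n := by
  induction n with
  | zero => rfl
  | succ n ih =>
    simp only [runMax]
    rw [ih fun j hj => h j (hj.trans n.lt_succ_self),
      Finset.sum_congr rfl fun j hj => h j (Finset.mem_range.1 hj)]

@[fun_prop]
lemma measurable_runMax (n : ℕ) : Measurable fun x : ℕ → ℝ => runMax x n := by
  induction n with
  | zero => exact measurable_const
  | succ n ih =>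
    exact ih.max (Finset.measurable_sum _ fun j _ => measurable_pi_apply j)

/-- A pathwise form of Doob's `L²` inequality: the square of the running maximum is bounded by the
sum of squares up to a term `∑ k, g k * x k` in which `g k` only depends on `x 0, …, x (k - 1)`. -/
lemma sq_runMax_le (x : ℕ → ℝ) (n : ℕ) :
    runMax x n ^ 2 ≤ 4 * ∑ k ∈ Finset.range n, x k ^ 2 +
      ∑ k ∈ Finset.range n, (8 * ∑ j ∈ Finset.range k, x j - 4 * runMax x k) * x k := by
  have hsq : ∀ n, (∑ j ∈ Finset.range n, x j) ^ 2 = ∑ k ∈ Finset.range n, x k ^ 2 +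
      2 * ∑ k ∈ Finset.range n, (∑ j ∈ Finset.range k, x j) * x k := by
    intro n
    induction n with
    | zero => simp
    | succ n ih => simp only [Finset.sum_range_succ]; nlinarith
  -- summation by parts; the maximum only moves at times when it equals the partial sum
  have habel : ∀ n, runMax x n ^ 2 / 2 ≤ runMax x n * ∑ j ∈ Finset.range n, x j -
      ∑ k ∈ Finset.range n, runMax x k * x k := by
    intro n
    induction n with
    | zero => simp [runMax]
    | succ n ih =>
      simp only [runMax]
      rcases le_total (runMax x n) (∑ j ∈ Finset.range (n + 1), x j) with h | h
      · rw [max_eq_right h]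
        simp only [Finset.sum_range_succ] at h ⊢
        nlinarith [sq_nonneg (runMax x n - (∑ j ∈ Finset.range n, x j + x n))]
      · rw [max_eq_left h]
        simp only [Finset.sum_range_succ]
        nlinarith
  have h1 := habel n
  have h2 := hsq n
  have h3 : ∑ k ∈ Finset.range n, (8 * ∑ j ∈ Finset.range k, x j - 4 * runMax x k) * x k =
      8 * ∑ k ∈ Finset.range n, (∑ j ∈ Finset.range k, x j) * x k -
        4 * ∑ k ∈ Finset.range n, runMax x k * x k := by
    rw [Finset.mul_sum, Finset.mul_sum, ← Finset.sum_sub_distrib]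
    exact Finset.sum_congr rfl fun k _ => by ring
  rw [h3]
  nlinarith [sq_nonneg (runMax x n - 2 * ∑ j ∈ Finset.range n, x j)]

/-- Abel summation: decreasing weights in `[0, 1]` do not push a sum above the running maximum. -/
lemma sum_mul_le_runMax (x b : ℕ → ℝ) (n : ℕ) (h0 : ∀ i < n, 0 ≤ b i) (h1 : ∀ i < n, b i ≤ 1)
    (hb : ∀ i j, i ≤ j → j < n → b j ≤ b i) :
    ∑ i ∈ Finset.range n, b i * x i ≤ runMax x n := by
  cases n with
  | zero => simp [runMax]
  | succ n =>
    have key : ∀ k ≤ n, ∑ i ∈ Finset.range (k + 1), b i * x i ≤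
        b k * ∑ i ∈ Finset.range (k + 1), x i + (b 0 - b k) * runMax x (n + 1) := by
      intro k hk
      induction k with
      | zero => simp
      | succ k ih =>
        have h2 := ih (by omega)
        have h3 := sum_range_le_runMax x (show k + 1 ≤ n + 1 by omega)
        have h4 := hb k (k + 1) (by omega) (by omega)
        rw [Finset.sum_range_succ, Finset.sum_range_succ (n := k + 1) (f := x)]
        nlinarith [mul_le_mul_of_nonneg_left h3 (sub_nonneg.2 h4)]
    have h2 := key n le_rfl
    have h3 := sum_range_le_runMax x (le_refl (n + 1))
    have h4 := h0 n (by omega)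
    have h5 := h1 0 (by omega)
    nlinarith [mul_le_mul_of_nonneg_left h3 h4, runMax_nonneg x (n + 1)]

/-- The sum of the running maxima of the partial sums of `x` and of `-x`; it bounds the absolute
values of all partial sums. -/
noncomputable def absRunMax (x : ℕ → ℝ) (n : ℕ) : ℝ := runMax x n + runMax (-x) n

lemma abs_sum_mul_le_absRunMax (x b : ℕ → ℝ) (n : ℕ) (h0 : ∀ i < n, 0 ≤ b i)
    (h1 : ∀ i < n, b i ≤ 1) (hb : ∀ i j, i ≤ j → j < n → b j ≤ b i) :
    |∑ i ∈ Finset.range n, b i * x i| ≤ absRunMax x n := by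
  have h2 := sum_mul_le_runMax x b n h0 h1 hb
  have h3 := sum_mul_le_runMax (-x) b n h0 h1 hb
  simp only [Pi.neg_apply, mul_neg, Finset.sum_neg_distrib] at h3
  have h4 := runMax_nonneg x n
  have h5 := runMax_nonneg (-x) n
  rw [abs_le, absRunMax]
  constructor <;> linarith

/-- There is a bijection of `ℕ` that permutes `{0, …, p - 1}` so that `τ` becomes increasing
there. -/
lemma exists_perm_monotoneOn (τ : ℕ → ℝ) (p : ℕ) :
    ∃ σ : Equiv.Perm ℕ, (∀ i, σ i < p ↔ i < p) ∧
      ∀ i j, i ≤ j → j < p → τ (σ i) ≤ τ (σ j) := by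
  let s := Tuple.sort fun i : Fin p => τ i
  have hs : Monotone ((fun i : Fin p => τ i) ∘ s) := Tuple.monotone_sort _
  have hlt : ∀ i (h : i < p), s.extendDomain Fin.equivSubtype i = s ⟨i, h⟩ := fun i h =>
    s.extendDomain_apply_subtype (p := fun i => i < p) Fin.equivSubtype h
  refine ⟨s.extendDomain Fin.equivSubtype, fun i => ?_, fun i j hij hj => ?_⟩
  · by_cases h : i < p
    · simp [hlt i h, h]
    · rw [s.extendDomain_apply_not_subtype (p := fun i => i < p) Fin.equivSubtype h]
  · rw [hlt i (hij.trans_lt hj), hlt j hj]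
    exact hs (show (⟨i, hij.trans_lt hj⟩ : Fin p) ≤ ⟨j, hj⟩ from hij)

lemma sum_range_comp_perm (σ : Equiv.Perm ℕ) {p : ℕ} (hσ : ∀ i, σ i < p ↔ i < p) (f : ℕ → ℝ) :
    ∑ i ∈ Finset.range p, f (σ i) = ∑ i ∈ Finset.range p, f i :=
  Finset.sum_equiv σ (by simp [hσ]) fun _ _ => rfl

/-! ### The maximal inequality for independent variables -/

section Maximal

variable {Ω : Type*} [MeasurableSpace Ω] {P : Measure Ω}

lemma memLp_runMax {X : ℕ → Ω → ℝ} (hX : ∀ i, MemLp (X i) 2 P) (n : ℕ) :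
    MemLp (fun ω => runMax (fun i => X i ω) n) 2 P := by
  induction n with
  | zero => exact MemLp.zero'
  | succ n ih => exact ih.sup (memLp_finsetSum _ fun j _ => hX j)

/-- **Doob's `L²` inequality** for sums of independent centred variables. -/
lemma integral_sq_runMax_le [IsProbabilityMeasure P] {X : ℕ → Ω → ℝ} (hind : iIndepFun X P)
    (hX : ∀ i, MemLp (X i) 2 P) (h0 : ∀ i, ∫ ω, X i ω ∂P = 0) (n : ℕ) :
    ∫ ω, runMax (fun i => X i ω) n ^ 2 ∂P ≤
      4 * ∑ i ∈ Finset.range n, ∫ ω, X i ω ^ 2 ∂P := by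
  let G : ℕ → (ℕ → ℝ) → ℝ := fun k x => 8 * ∑ j ∈ Finset.range k, x j - 4 * runMax x k
  have hGm : ∀ k, Measurable (G k) := fun k => by
    refine ((Finset.measurable_sum _ fun j _ => measurable_pi_apply j).const_mul 8).sub
      ((measurable_runMax k).const_mul 4)
  have hG2 : ∀ k, MemLp (fun ω => G k fun i => X i ω) 2 P := fun k =>
    ((memLp_finsetSum _ fun j _ => hX j).const_mul 8).sub ((memLp_runMax hX k).const_mul 4)
  have hGX : ∀ k, Integrable (fun ω => G k (fun i => X i ω) * X k ω) P := fun k =>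
    (hG2 k).integrable_mul (hX k)
  have hzero : ∀ k, ∫ ω, G k (fun i => X i ω) * X k ω ∂P = 0 := by
    intro k
    -- `G k` factors through the first `k` coordinates, extended by zero
    let ext : (Finset.range k → ℝ) → ℕ → ℝ := fun u j =>
      if h : j ∈ Finset.range k then u ⟨j, h⟩ else 0
    have hext : Measurable ext := by
      refine measurable_pi_lambda _ fun j => ?_
      by_cases h : j ∈ Finset.range k
      · simp only [ext, dif_pos h]
        exact measurable_pi_apply _
      · simp only [ext, dif_neg h]
        exact measurable_const
    have hi := (hind.indepFun_finset₀ (Finset.range k) {k} (by simp)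
      fun i => (hX i).aestronglyMeasurable.aemeasurable).comp ((hGm k).comp hext)
      (measurable_pi_apply (⟨k, by simp⟩ : ({k} : Finset ℕ)))
    have hcongr : (fun ω => G k fun i => X i ω) =
        (G k ∘ ext) ∘ fun ω (i : Finset.range k) => X i ω := by
      funext ω
      have hx : ∀ j < k, X j ω = ext (fun i : Finset.range k => X i ω) j := fun j hj => by
        simp [ext, hj]
      simp only [Function.comp_apply, G]
      rw [runMax_congr hx, Finset.sum_congr rfl fun j hj => hx j (Finset.mem_range.1 hj)]
    have hi' : IndepFun (fun ω => G k fun i => X i ω) (X k) P := by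
      rw [hcongr]; exact hi
    rw [hi'.integral_fun_mul_eq_mul_integral (hG2 k).aestronglyMeasurable
      (hX k).aestronglyMeasurable, h0 k, mul_zero]
  calc ∫ ω, runMax (fun i => X i ω) n ^ 2 ∂P
      ≤ ∫ ω, (4 * ∑ k ∈ Finset.range n, X k ω ^ 2 +
          ∑ k ∈ Finset.range n, G k (fun i => X i ω) * X k ω) ∂P := by
        refine integral_mono (memLp_runMax hX n).integrable_sq ?_ fun ω => sq_runMax_le _ n
        exact ((integrable_finsetSum _ fun k _ => (hX k).integrable_sq).const_mul 4).add
          (integrable_finsetSum _ fun k _ => hGX k)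
    _ = _ := by
        rw [integral_add ((integrable_finsetSum _ fun k _ => (hX k).integrable_sq).const_mul 4)
          (integrable_finsetSum _ fun k _ => hGX k), integral_const_mul,
          integral_finsetSum _ fun k _ => (hX k).integrable_sq,
          integral_finsetSum _ fun k _ => hGX k]
        simp [hzero]

lemma memLp_absRunMax {X : ℕ → Ω → ℝ} (hX : ∀ i, MemLp (X i) 2 P) (n : ℕ) :
    MemLp (fun ω => absRunMax (fun i => X i ω) n) 2 P :=
  (memLp_runMax hX n).add (memLp_runMax (fun i => (hX i).neg) n)

lemma integral_sq_absRunMax_le [IsProbabilityMeasure P] {X : ℕ → Ω → ℝ} (hind : iIndepFun X P)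
    (hX : ∀ i, MemLp (X i) 2 P) (h0 : ∀ i, ∫ ω, X i ω ∂P = 0) (n : ℕ) :
    ∫ ω, absRunMax (fun i => X i ω) n ^ 2 ∂P ≤
      16 * ∑ i ∈ Finset.range n, ∫ ω, X i ω ^ 2 ∂P := by
  have hneg : iIndepFun (fun i => -X i) P := hind.comp (fun _ x => -x) fun _ => measurable_neg
  have h1 := integral_sq_runMax_le hind hX h0 n
  have h2 := integral_sq_runMax_le hneg (fun i => (hX i).neg)
    (fun i => by simp [integral_neg, h0 i]) n
  have i1 := (memLp_runMax hX n).integrable_sq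
  have i2 := (memLp_runMax (fun i => (hX i).neg) n).integrable_sq
  calc ∫ ω, absRunMax (fun i => X i ω) n ^ 2 ∂P
      ≤ ∫ ω, (2 * runMax (fun i => X i ω) n ^ 2 + 2 * runMax (fun i => (-X i) ω) n ^ 2) ∂P := by
        refine integral_mono (memLp_absRunMax hX n).integrable_sq
          ((i1.const_mul 2).add (i2.const_mul 2)) fun ω => ?_
        exact (add_sq_le (a := runMax (fun i => X i ω) n)
          (b := runMax (fun i => (-X i) ω) n)).trans_eq (by ring)
    _ ≤ _ := by
        rw [integral_add (i1.const_mul 2) (i2.const_mul 2), integral_const_mul, integral_const_mul]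
        simp only [Pi.neg_apply, neg_sq] at h2
        simp only [Pi.neg_apply] at h2 ⊢
        linarith

end Maximal

/-! ### Shrinkage weights and a pathwise bound -/

lemma shrinkWeight_nonneg {t : ℝ} (ht : 0 < t) (γ : ℝ≥0∞) : 0 ≤ shrinkWeight t γ := by
  unfold shrinkWeight
  split_ifs
  · exact zero_le_one
  · positivity

lemma shrinkWeight_le_one {t : ℝ} (ht : 0 < t) (γ : ℝ≥0∞) : shrinkWeight t γ ≤ 1 := by
  unfold shrinkWeight
  split_ifs
  · exact le_rfl
  · have := γ.toReal_nonneg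
    exact div_le_one_of_le₀ (by linarith) (by linarith)

lemma shrinkWeight_anti {t u : ℝ} (ht : 0 < t) (htu : t ≤ u) (γ : ℝ≥0∞) :
    shrinkWeight u γ ≤ shrinkWeight t γ := by
  unfold shrinkWeight
  split_ifs
  · exact le_rfl
  · have := γ.toReal_nonneg
    gcongr

lemma continuous_shrinkWeight {t : ℝ} (ht : 0 < t) : Continuous (shrinkWeight t) := by
  have h : shrinkWeight t = fun γ => 1 - (ENNReal.ofReal t * (ENNReal.ofReal t + γ)⁻¹).toReal := by
    funext γ
    unfold shrinkWeight
    split_ifs with hγ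
    · simp [hγ]
    · have := γ.toReal_nonneg
      rw [ENNReal.toReal_mul, ENNReal.toReal_inv, ENNReal.toReal_add (by simp) hγ,
        ENNReal.toReal_ofReal ht.le]
      field_simp
      ring
  rw [h]
  refine continuous_const.sub (ENNReal.continuousOn_toReal.comp_continuous ?_ fun γ => ?_)
  · exact (ENNReal.continuous_const_mul ENNReal.ofReal_ne_top).comp
      (continuous_inv.comp (by fun_prop : Continuous fun γ : ℝ≥0∞ => ENNReal.ofReal t + γ))
  · exact ENNReal.mul_ne_top ENNReal.ofReal_ne_top
      (ENNReal.inv_ne_top.2 (by simp [ht]))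

/-- The error of the unbiased estimate `V(Y) / (τ + ν₂)` of the variance, relative to the squared
deviation from the mean. -/
noncomputable def varError (ν₀ ν₁ ν₂ τ θ y : ℝ) : ℝ :=
  (ν₀ + ν₁ * y + ν₂ * y ^ 2) / (τ + ν₂) - (y - θ) ^ 2

/-- The value at `μ = 0` of the difference between the risk estimate and the loss. -/
noncomputable def discrepancyConst (ν₀ ν₁ ν₂ : ℝ) (τ θ : ℕ → ℝ) (p : ℕ) (y : ℕ → ℝ)
    (γ : ℝ≥0∞) : ℝ :=
  1 / (p : ℝ) * (∑ i ∈ Finset.range p, varError ν₀ ν₁ ν₂ (τ i) (θ i) (y i) -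
    2 * ∑ i ∈ Finset.range p, shrinkWeight (τ i) γ * varError ν₀ ν₁ ν₂ (τ i) (θ i) (y i) +
    2 * ∑ i ∈ Finset.range p, shrinkWeight (τ i) γ * ((y i - θ i) * θ i))

/-- The slope in `μ` of the difference between the risk estimate and the loss. -/
noncomputable def discrepancySlope (τ θ : ℕ → ℝ) (p : ℕ) (y : ℕ → ℝ) (γ : ℝ≥0∞) : ℝ :=
  1 / (p : ℝ) * (-2 * ∑ i ∈ Finset.range p, shrinkWeight (τ i) γ * (y i - θ i))

/-- The terms quadratic in `μ` cancel, so that the difference is affine in `μ`. -/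
lemma parametricURE_sub_sqLoss (ν₀ ν₁ ν₂ : ℝ) (τ θ : ℕ → ℝ) (p : ℕ) (y : ℕ → ℝ) (γ : ℝ≥0∞)
    (μ : ℝ) : parametricURE ν₀ ν₁ ν₂ τ p y γ μ - sqLoss p θ (conjEstimator τ y γ μ) =
      discrepancyConst ν₀ ν₁ ν₂ τ θ p y γ + discrepancySlope τ θ p y γ * μ := by
  unfold parametricURE sqLoss conjEstimator discrepancyConst discrepancySlope varError
  rw [← mul_sub, mul_assoc (1 / (p : ℝ)), ← mul_add]
  congr 1
  rw [← Finset.sum_sub_distrib, mul_assoc, Finset.sum_mul, Finset.mul_sum, Finset.mul_sum,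
    Finset.mul_sum, ← Finset.sum_sub_distrib, ← Finset.sum_add_distrib, ← Finset.sum_add_distrib]
  exact Finset.sum_congr rfl fun i _ => by ring

/-- A truncation at level `K`: large values of `|θ i|` and `|y i - θ i|` are dominated by the third
and fourth powers. -/
lemma sq_iSup_abs_le (p : ℕ) (y θ : ℕ → ℝ) {K : ℝ} (hK : 0 < K) :
    (⨆ i : Fin p, |y i|) ^ 2 ≤ 4 * K ^ 2 + 2 / K * ∑ i ∈ Finset.range p, |θ i| ^ 3 +
      2 / K ^ 2 * ∑ i ∈ Finset.range p, (y i - θ i) ^ 4 := by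
  have hs1 : 0 ≤ ∑ i ∈ Finset.range p, |θ i| ^ 3 := Finset.sum_nonneg fun i _ => by positivity
  have hs2 : 0 ≤ ∑ i ∈ Finset.range p, (y i - θ i) ^ 4 := Finset.sum_nonneg fun i _ => by positivity
  rcases isEmpty_or_nonempty (Fin p) with h | h
  · rw [Real.iSup_of_isEmpty, zero_pow two_ne_zero]
    positivity
  obtain ⟨i, hi⟩ := exists_eq_ciSup_of_finite (f := fun i : Fin p => |y i|)
  rw [← hi, sq_abs]
  have hmem : (i : ℕ) ∈ Finset.range p := Finset.mem_range.2 i.isLt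
  have h1 : |θ i| ^ 3 ≤ ∑ i ∈ Finset.range p, |θ i| ^ 3 :=
    Finset.single_le_sum (f := fun i => |θ i| ^ 3) (fun j _ => by positivity) hmem
  have h2 : (y i - θ i) ^ 4 ≤ ∑ i ∈ Finset.range p, (y i - θ i) ^ 4 :=
    Finset.single_le_sum (f := fun i => (y i - θ i) ^ 4) (fun j _ => by positivity) hmem
  have h3 : θ i ^ 2 ≤ K ^ 2 + 1 / K * |θ i| ^ 3 := by
    rw [← sq_abs (θ i)]
    have ha := abs_nonneg (θ i)
    rcases le_total |θ i| K with h | h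
    · nlinarith [show 0 ≤ 1 / K * |θ i| ^ 3 by positivity]
    · have : |θ i| ^ 2 ≤ 1 / K * |θ i| ^ 3 := by
        rw [one_div, ← div_eq_inv_mul, le_div_iff₀ hK]
        nlinarith [sq_nonneg |θ i|]
      nlinarith
  have h4 : (y i - θ i) ^ 2 ≤ K ^ 2 + 1 / K ^ 2 * (y i - θ i) ^ 4 := by
    have : 1 / K ^ 2 * (y i - θ i) ^ 4 = ((y i - θ i) ^ 2 / K) ^ 2 := by field_simp
    rw [this]
    have h5 : (y i - θ i) ^ 2 = K * ((y i - θ i) ^ 2 / K) := by field_simp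
    nlinarith [sq_nonneg (K - (y i - θ i) ^ 2 / K)]
  have h6 : y i ^ 2 ≤ 2 * θ i ^ 2 + 2 * (y i - θ i) ^ 2 := by
    nlinarith [sq_nonneg (y i - 2 * θ i)]
  have h7 := mul_le_mul_of_nonneg_left h1 (show 0 ≤ 2 / K by positivity)
  have h8 := mul_le_mul_of_nonneg_left h2 (show 0 ≤ 2 / K ^ 2 by positivity)
  have h9 : 2 / K = 2 * (1 / K) := by ring
  have h10 : 2 / K ^ 2 = 2 * (1 / K ^ 2) := by ring
  rw [h9] at h7 ⊢
  rw [h10] at h8 ⊢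
  linarith

/-- Monotonicity of the weights in `τ` turns a supremum over `γ` into a running maximum along an
order in which `τ` increases. -/
lemma abs_sum_shrinkWeight_le {τ : ℕ → ℝ} (hτ : ∀ i, 0 < τ i) {p : ℕ} {σ : Equiv.Perm ℕ}
    (hσ : ∀ i, σ i < p ↔ i < p) (hmono : ∀ i j, i ≤ j → j < p → τ (σ i) ≤ τ (σ j))
    (x : ℕ → ℝ) (γ : ℝ≥0∞) :
    |∑ i ∈ Finset.range p, shrinkWeight (τ i) γ * x i| ≤ absRunMax (fun i => x (σ i)) p := by
  rw [← sum_range_comp_perm σ hσ]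
  exact abs_sum_mul_le_absRunMax _ (fun i => shrinkWeight (τ (σ i)) γ) p
    (fun i _ => shrinkWeight_nonneg (hτ _) γ) (fun i _ => shrinkWeight_le_one (hτ _) γ)
    fun i j hij hj => shrinkWeight_anti (hτ _) (hmono i j hij hj) γ

lemma supDiscrepancy_le (ν₀ ν₁ ν₂ : ℝ) {τ : ℕ → ℝ} (hτ : ∀ i, 0 < τ i) (θ : ℕ → ℝ) (Θ : Set ℝ)
    {p : ℕ} {σ : Equiv.Perm ℕ} (hσ : ∀ i, σ i < p ↔ i < p)
    (hmono : ∀ i j, i ≤ j → j < p → τ (σ i) ≤ τ (σ j)) (y : ℕ → ℝ) :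
    supDiscrepancy ν₀ ν₁ ν₂ τ θ Θ p y ≤ ENNReal.ofReal (1 / (p : ℝ) *
      (3 * absRunMax (fun i => varError ν₀ ν₁ ν₂ (τ (σ i)) (θ (σ i)) (y (σ i))) p +
        2 * absRunMax (fun i => (y (σ i) - θ (σ i)) * θ (σ i)) p +
        2 * (⨆ i : Fin p, |y i|) * absRunMax (fun i => y (σ i) - θ (σ i)) p)) := by
  refine iSup_le fun γ => iSup_le fun μ => iSup_le fun hμ => ENNReal.ofReal_le_ofReal ?_
  rw [parametricURE_sub_sqLoss]
  unfold discrepancyConst discrepancySlope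
  rw [mul_assoc (1 / (p : ℝ)), ← mul_add, abs_mul, abs_of_nonneg (by positivity : 0 ≤ 1 / (p : ℝ))]
  refine mul_le_mul_of_nonneg_left ?_ (by positivity)
  have h0 : |∑ i ∈ Finset.range p, varError ν₀ ν₁ ν₂ (τ i) (θ i) (y i)| ≤
      absRunMax (fun i => varError ν₀ ν₁ ν₂ (τ (σ i)) (θ (σ i)) (y (σ i))) p := by
    have := abs_sum_shrinkWeight_le hτ hσ hmono
      (fun i => varError ν₀ ν₁ ν₂ (τ i) (θ i) (y i)) ∞
    simpa [shrinkWeight] using this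
  have h1 := abs_sum_shrinkWeight_le hτ hσ hmono
    (fun i => varError ν₀ ν₁ ν₂ (τ i) (θ i) (y i)) γ
  have h2 := abs_sum_shrinkWeight_le hτ hσ hmono (fun i => (y i - θ i) * θ i) γ
  have h3 := abs_sum_shrinkWeight_le hτ hσ hmono (fun i => y i - θ i) γ
  have h4 : |(∑ i ∈ Finset.range p, shrinkWeight (τ i) γ * (y i - θ i)) * μ| ≤
      (⨆ i : Fin p, |y i|) * absRunMax (fun i => y (σ i) - θ (σ i)) p := by
    rw [abs_mul, mul_comm]
    exact mul_le_mul hμ.2 h3 (abs_nonneg _) ((abs_nonneg _).trans hμ.2)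
  rw [abs_le] at h0 h1 h2 h4 ⊢
  constructor <;> linarith

/-! ### Measurability of the supremum -/

/-- The elements of `Θ` of absolute value at most `m`. -/
def boundedPart (Θ : Set ℝ) (m : ℝ) : Set ℝ := {μ | μ ∈ Θ ∧ |μ| ≤ m}

/-- The supremum of the elements of `Θ` of absolute value at most `m`. It is defined through the
extended reals, where it is monotone in `m` also when there are no such elements. -/
noncomputable def boundedSup (Θ : Set ℝ) (m : ℝ) : ℝ :=
  (⨆ μ ∈ boundedPart Θ m, (μ : EReal)).toReal

/-- The infimum of the elements of `Θ` of absolute value at most `m`, defined through the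
extended reals. -/
noncomputable def boundedInf (Θ : Set ℝ) (m : ℝ) : ℝ :=
  (⨅ μ ∈ boundedPart Θ m, (μ : EReal)).toReal

lemma boundedPart_mono (Θ : Set ℝ) {m n : ℝ} (h : m ≤ n) : boundedPart Θ m ⊆ boundedPart Θ n :=
  fun _ hμ => ⟨hμ.1, hμ.2.trans h⟩

lemma measurable_boundedSup (Θ : Set ℝ) : Measurable (boundedSup Θ) := by
  refine Measurable.ereal_toReal (Monotone.measurable fun m n h => ?_)
  exact biSup_mono fun μ hμ => boundedPart_mono Θ h hμ

lemma measurable_boundedInf (Θ : Set ℝ) : Measurable (boundedInf Θ) := by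
  refine Measurable.ereal_toReal (Antitone.measurable fun m n h => ?_)
  exact biInf_mono fun μ hμ => boundedPart_mono Θ h hμ

lemma isLUB_boundedSup {Θ : Set ℝ} {m : ℝ} (h : (boundedPart Θ m).Nonempty) :
    IsLUB (boundedPart Θ m) (boundedSup Θ m) := by
  obtain ⟨μ, hμ⟩ := h
  have h1 : (μ : EReal) ≤ ⨆ μ ∈ boundedPart Θ m, (μ : EReal) := le_biSup _ hμ
  have h2 : ∀ u ∈ upperBounds (boundedPart Θ m), ⨆ μ ∈ boundedPart Θ m, (μ : EReal) ≤ u :=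
    fun u hu => iSup₂_le fun x hx => EReal.coe_le_coe_iff.2 (hu hx)
  have hm : m ∈ upperBounds (boundedPart Θ m) := fun x hx => (le_abs_self x).trans hx.2
  have h3 : ((boundedSup Θ m : ℝ) : EReal) = ⨆ μ ∈ boundedPart Θ m, (μ : EReal) :=
    EReal.coe_toReal (ne_top_of_le_ne_top (EReal.coe_ne_top m) (h2 m hm))
      (ne_bot_of_le_ne_bot (EReal.coe_ne_bot μ) h1)
  refine ⟨fun x hx => EReal.coe_le_coe_iff.1 ?_, fun u hu => EReal.coe_le_coe_iff.1 ?_⟩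
  · rw [h3]; exact le_biSup (fun x : ℝ => (x : EReal)) hx
  · rw [h3]; exact h2 u hu

lemma isGLB_boundedInf {Θ : Set ℝ} {m : ℝ} (h : (boundedPart Θ m).Nonempty) :
    IsGLB (boundedPart Θ m) (boundedInf Θ m) := by
  obtain ⟨μ, hμ⟩ := h
  have h1 : ⨅ μ ∈ boundedPart Θ m, (μ : EReal) ≤ μ := biInf_le _ hμ
  have h2 : ∀ u ∈ lowerBounds (boundedPart Θ m), (u : EReal) ≤ ⨅ μ ∈ boundedPart Θ m, (μ : EReal) :=
    fun u hu => le_iInf₂ fun x hx => EReal.coe_le_coe_iff.2 (hu hx)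
  have hm : -m ∈ lowerBounds (boundedPart Θ m) := fun x hx => (abs_le.1 hx.2).1
  have h3 : ((boundedInf Θ m : ℝ) : EReal) = ⨅ μ ∈ boundedPart Θ m, (μ : EReal) :=
    EReal.coe_toReal (ne_top_of_le_ne_top (EReal.coe_ne_top μ) h1)
      (ne_bot_of_le_ne_bot (EReal.coe_ne_bot (-m)) (h2 _ hm))
  refine ⟨fun x hx => EReal.coe_le_coe_iff.1 ?_, fun u hu => EReal.coe_le_coe_iff.1 ?_⟩
  · rw [h3]; exact biInf_le (fun x : ℝ => (x : EReal)) hx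
  · rw [h3]; exact h2 u hu

/-- The supremum of `|a + b μ|` over a bounded set of `μ` is attained at its end points, which lie
in the closure of the set. -/
lemma iSup_abs_affine {Θ : Set ℝ} {m : ℝ} (h : (boundedPart Θ m).Nonempty) (a b : ℝ) :
    ⨆ (μ : ℝ) (_ : μ ∈ boundedPart Θ m), ENNReal.ofReal |a + b * μ| =
      max (ENNReal.ofReal |a + b * boundedInf Θ m|) (ENNReal.ofReal |a + b * boundedSup Θ m|) := by
  have hs := isLUB_boundedSup h
  have hi := isGLB_boundedInf h
  refine le_antisymm (iSup₂_le fun μ hμ => ?_) ?_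
  · have h1 : |a + b * μ| ≤ max |a + b * boundedInf Θ m| |a + b * boundedSup Θ m| := by
      have h2 := hs.1 hμ
      have h3 := hi.1 hμ
      rcases le_total 0 b with hb | hb
      · exact abs_le_max_abs_abs (by nlinarith) (by nlinarith)
      · rw [max_comm]
        exact abs_le_max_abs_abs (by nlinarith) (by nlinarith)
    exact (ENNReal.ofReal_le_ofReal h1).trans_eq (ENNReal.ofReal_max _ _)
  · have hcl : IsClosed {x : ℝ | ENNReal.ofReal |a + b * x| ≤
        ⨆ (μ : ℝ) (_ : μ ∈ boundedPart Θ m), ENNReal.ofReal |a + b * μ|} :=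
      isClosed_le (ENNReal.continuous_ofReal.comp (by fun_prop)) continuous_const
    have hsub : boundedPart Θ m ⊆ {x : ℝ | ENNReal.ofReal |a + b * x| ≤
        ⨆ (μ : ℝ) (_ : μ ∈ boundedPart Θ m), ENNReal.ofReal |a + b * μ|} := fun x hx =>
      le_biSup (fun μ : ℝ => ENNReal.ofReal |a + b * μ|) hx
    exact max_le (closure_minimal hsub hcl (hi.mem_closure h))
      (closure_minimal hsub hcl (hs.mem_closure h))

lemma DenseRange.iSup_comp_eq {α ι : Type*} [TopologicalSpace α] {u : ι → α} (hu : DenseRange u)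
    {f : α → ℝ≥0∞} (hf : Continuous f) : ⨆ x, f x = ⨆ i, f (u i) := by
  refine le_antisymm (iSup_le fun x => ?_) (iSup_le fun i => le_iSup f (u i))
  exact hu.induction_on x (isClosed_le hf continuous_const) fun i => le_iSup (fun i => f (u i)) i

/-- For fixed `γ` the supremum over `μ` is attained at measurable end points, and by continuity the
supremum over `γ` can be restricted to a countable dense set. -/
lemma measurable_supDiscrepancy (ν₀ ν₁ ν₂ : ℝ) {τ : ℕ → ℝ} (hτ : ∀ i, 0 < τ i) (θ : ℕ → ℝ)
    (Θ : Set ℝ) (p : ℕ) : Measurable (supDiscrepancy ν₀ ν₁ ν₂ τ θ Θ p) := by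
  classical
  let m : (ℕ → ℝ) → ℝ := fun y => ⨆ i : Fin p, |y i|
  have hm : Measurable m := Measurable.iSup fun i => (measurable_pi_apply (i : ℕ)).abs
  let F : (ℕ → ℝ) → ℝ≥0∞ → ℝ≥0∞ := fun y γ =>
    max (ENNReal.ofReal |discrepancyConst ν₀ ν₁ ν₂ τ θ p y γ +
        discrepancySlope τ θ p y γ * boundedInf Θ (m y)|)
      (ENNReal.ofReal |discrepancyConst ν₀ ν₁ ν₂ τ θ p y γ +
        discrepancySlope τ θ p y γ * boundedSup Θ (m y)|)
  have hFc : ∀ y, Continuous (F y) := by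
    intro y
    have h1 : Continuous fun γ => discrepancyConst ν₀ ν₁ ν₂ τ θ p y γ := by
      have := fun i => continuous_shrinkWeight (hτ i)
      unfold discrepancyConst
      fun_prop
    have h2 : Continuous fun γ => discrepancySlope τ θ p y γ := by
      have := fun i => continuous_shrinkWeight (hτ i)
      unfold discrepancySlope
      fun_prop
    exact (ENNReal.continuous_ofReal.comp (by fun_prop)).max
      (ENNReal.continuous_ofReal.comp (by fun_prop))
  have hFm : ∀ γ, Measurable fun y => F y γ := by
    intro γ
    have h1 : Measurable fun y => discrepancyConst ν₀ ν₁ ν₂ τ θ p y γ := by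
      unfold discrepancyConst varError
      fun_prop
    have h2 : Measurable fun y => discrepancySlope τ θ p y γ := by
      unfold discrepancySlope
      fun_prop
    have h3 := (measurable_boundedInf Θ).comp hm
    have h4 := (measurable_boundedSup Θ).comp hm
    exact (ENNReal.measurable_ofReal.comp (h1.add (h2.mul h3)).abs).max
      (ENNReal.measurable_ofReal.comp (h1.add (h2.mul h4)).abs)
  have hset : MeasurableSet {y | (boundedPart Θ (m y)).Nonempty} := by
    have : MeasurableSet {x : ℝ | (boundedPart Θ x).Nonempty} :=
      (IsUpperSet.ordConnected fun a b hab ha =>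
        Set.Nonempty.mono (boundedPart_mono Θ hab) ha).measurableSet
    exact hm this
  have heq : supDiscrepancy ν₀ ν₁ ν₂ τ θ Θ p = fun y =>
      if (boundedPart Θ (m y)).Nonempty then
        ⨆ n : ℕ, F y (TopologicalSpace.denseSeq ℝ≥0∞ n) else 0 := by
    funext y
    have h1 : supDiscrepancy ν₀ ν₁ ν₂ τ θ Θ p y = ⨆ (γ : ℝ≥0∞) (μ : ℝ)
        (_ : μ ∈ boundedPart Θ (m y)), ENNReal.ofReal
          |discrepancyConst ν₀ ν₁ ν₂ τ θ p y γ + discrepancySlope τ θ p y γ * μ| := by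
      simp only [supDiscrepancy, parametricURE_sub_sqLoss]
      rfl
    rw [h1]
    split_ifs with h
    · rw [← DenseRange.iSup_comp_eq (TopologicalSpace.denseRange_denseSeq ℝ≥0∞) (hFc y)]
      exact iSup_congr fun γ => iSup_abs_affine h _ _
    · rw [Set.not_nonempty_iff_eq_empty] at h
      simp [h]
  rw [heq]
  exact Measurable.ite hset (Measurable.iSup fun n => hFm _) measurable_const

/-! ### Uniform convergence from moment bounds -/

section Uniform

variable {Ω : Type*} [MeasurableSpace Ω] {P : Measure Ω}

lemma memLp_sq_of_four {f : Ω → ℝ} (hf : MemLp f 4 P) : MemLp (fun ω => f ω ^ 2) 2 P := by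
  have : (4 : ℝ≥0∞) = 2 * 2 := by norm_num
  have h : ENNReal.HolderTriple 4 4 2 := ⟨by
    rw [this, ENNReal.mul_inv (by simp) (by simp), ← two_mul, ← mul_assoc,
      ENNReal.mul_inv_cancel (by simp) (by simp), one_mul]⟩
  simpa only [sq] using hf.mul' hf

variable [IsProbabilityMeasure P]

/-- What the argument needs from the observations: centred variance errors and deviations, and
moments whose partial sums grow at most linearly with rate `C`. -/
structure MomentBounds (P : Measure Ω) (Y : ℕ → Ω → ℝ) (ν₀ ν₁ ν₂ : ℝ) (τ θ : ℕ → ℝ)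
    (C : ℝ) : Prop where
  pos : ∀ i, 0 < τ i
  memLp : ∀ i, MemLp (Y i) 4 P
  integral_dev : ∀ i, ∫ ω, (Y i ω - θ i) ∂P = 0
  integral_varError : ∀ i, ∫ ω, varError ν₀ ν₁ ν₂ (τ i) (θ i) (Y i ω) ∂P = 0
  sum_varError : ∀ p, ∑ i ∈ Finset.range p,
    ∫ ω, varError ν₀ ν₁ ν₂ (τ i) (θ i) (Y i ω) ^ 2 ∂P ≤ C * p
  sum_dev_mul : ∀ p, ∑ i ∈ Finset.range p, ∫ ω, ((Y i ω - θ i) * θ i) ^ 2 ∂P ≤ C * p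
  sum_dev_sq : ∀ p, ∑ i ∈ Finset.range p, ∫ ω, (Y i ω - θ i) ^ 2 ∂P ≤ C * p
  sum_dev_four : ∀ p, ∑ i ∈ Finset.range p, ∫ ω, (Y i ω - θ i) ^ 4 ∂P ≤ C * p
  sum_mean : ∀ p, ∑ i ∈ Finset.range p, |θ i| ^ 3 ≤ C * p

lemma memLp_varError {f : Ω → ℝ} (hf : MemLp f 4 P) (ν₀ ν₁ ν₂ τ θ : ℝ) :
    MemLp (fun ω => varError ν₀ ν₁ ν₂ τ θ (f ω)) 2 P := by
  have h1 : MemLp f 2 P := hf.mono_exponent (by norm_num)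
  have h2 := memLp_sq_of_four hf
  have h3 := memLp_sq_of_four (hf.sub (memLp_const θ))
  have h4 := (((memLp_const ν₀).add (h1.const_mul ν₁)).add (h2.const_mul ν₂)).mul_const (τ + ν₂)⁻¹
  exact h4.sub h3

/-- The bound on the expected supremum, with a free scale `s > 0`: products are split by
`2 a b ≤ c a² + b² / c` with `c = s` or `c = s ^ 3`, and means and deviations are truncated at
`s ^ 2`. -/
noncomputable def expectedBound (C : ℝ) (p : ℕ) (s : ℝ) : ℝ :=
  1 / (p : ℝ) * (5 / 2 * (16 * C * p / s ^ 3 + s ^ 3) +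
    (s * (4 * (s ^ 2) ^ 2 + 2 / s ^ 2 * (C * p) + 2 / (s ^ 2) ^ 2 * (C * p)) + 16 * C * p / s))

lemma lintegral_supDiscrepancy_le {Y : ℕ → Ω → ℝ} {ν₀ ν₁ ν₂ : ℝ} {τ θ : ℕ → ℝ} {C : ℝ}
    (h : MomentBounds P Y ν₀ ν₁ ν₂ τ θ C) (hind : iIndepFun Y P) (Θ : Set ℝ) (p : ℕ) {s : ℝ}
    (hs : 0 < s) :
    ∫⁻ ω, supDiscrepancy ν₀ ν₁ ν₂ τ θ Θ p (fun i => Y i ω) ∂P ≤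
      ENNReal.ofReal (expectedBound C p s) := by
  obtain ⟨σ, hσ, hmono⟩ := exists_perm_monotoneOn τ p
  have hY2 : ∀ i, MemLp (fun ω => Y i ω - θ i) 4 P := fun i => (h.memLp i).sub (memLp_const _)
  -- the three sequences of centred summands, in an order in which `τ` increases
  let A : ℕ → Ω → ℝ := fun i ω => varError ν₀ ν₁ ν₂ (τ (σ i)) (θ (σ i)) (Y (σ i) ω)
  let B : ℕ → Ω → ℝ := fun i ω => (Y (σ i) ω - θ (σ i)) * θ (σ i)
  let Z : ℕ → Ω → ℝ := fun i ω => Y (σ i) ω - θ (σ i)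
  have hindσ : iIndepFun (fun i => Y (σ i)) P := hind.precomp σ.injective
  have hAind : iIndepFun A P := hindσ.comp
    (fun i y => varError ν₀ ν₁ ν₂ (τ (σ i)) (θ (σ i)) y) fun i => by unfold varError; fun_prop
  have hBind : iIndepFun B P := hindσ.comp
    (fun i y => (y - θ (σ i)) * θ (σ i)) fun i => by fun_prop
  have hZind : iIndepFun Z P := hindσ.comp (fun i y => y - θ (σ i)) fun i => by fun_prop
  have hA2 : ∀ i, MemLp (A i) 2 P := fun i => memLp_varError (h.memLp _) _ _ _ _ _
  have hZ2 : ∀ i, MemLp (Z i) 2 P := fun i => (hY2 _).mono_exponent (by norm_num)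
  have hB2 : ∀ i, MemLp (B i) 2 P := fun i => (hZ2 i).mul_const _
  have hA := integral_sq_absRunMax_le hAind hA2 (fun i => h.integral_varError _) p
  have hZ := integral_sq_absRunMax_le hZind hZ2 (fun i => h.integral_dev _) p
  have hB := integral_sq_absRunMax_le hBind hB2
    (fun i => by simp only [B, integral_mul_const, h.integral_dev, zero_mul]) p
  rw [sum_range_comp_perm σ hσ fun i => ∫ ω, varError ν₀ ν₁ ν₂ (τ i) (θ i) (Y i ω) ^ 2 ∂P] at hA
  rw [sum_range_comp_perm σ hσ fun i => ∫ ω, (Y i ω - θ i) ^ 2 ∂P] at hZ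
  rw [sum_range_comp_perm σ hσ fun i => ∫ ω, ((Y i ω - θ i) * θ i) ^ 2 ∂P] at hB
  have iA := (memLp_absRunMax hA2 p).integrable_sq
  have iB := (memLp_absRunMax hB2 p).integrable_sq
  have iZ := (memLp_absRunMax hZ2 p).integrable_sq
  have i4 : ∀ i, Integrable (fun ω => (Y i ω - θ i) ^ 4) P := fun i => by
    simpa only [← pow_mul] using (memLp_sq_of_four (hY2 i)).integrable_sq
  have i4s : Integrable (fun ω => ∑ i ∈ Finset.range p, (Y i ω - θ i) ^ 4) P :=
    integrable_finsetSum _ fun i _ => i4 i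
  let T : ℝ := ∑ i ∈ Finset.range p, |θ i| ^ 3
  let R : Ω → ℝ := fun ω => 1 / (p : ℝ) *
    (3 / 2 * (1 / s ^ 3 * absRunMax (fun i => A i ω) p ^ 2 + s ^ 3) +
      (1 / s ^ 3 * absRunMax (fun i => B i ω) p ^ 2 + s ^ 3) +
      (s * (4 * (s ^ 2) ^ 2 + 2 / s ^ 2 * T +
        2 / (s ^ 2) ^ 2 * ∑ i ∈ Finset.range p, (Y i ω - θ i) ^ 4) +
        1 / s * absRunMax (fun i => Z i ω) p ^ 2))
  have j1 : Integrable
      (fun ω => 3 / 2 * (1 / s ^ 3 * absRunMax (fun i => A i ω) p ^ 2 + s ^ 3)) P :=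
    ((iA.const_mul _).add (integrable_const _)).const_mul _
  have j2 : Integrable (fun ω => 1 / s ^ 3 * absRunMax (fun i => B i ω) p ^ 2 + s ^ 3) P :=
    (iB.const_mul _).add (integrable_const _)
  have j3 : Integrable (fun ω => 4 * (s ^ 2) ^ 2 + 2 / s ^ 2 * T +
      2 / (s ^ 2) ^ 2 * ∑ i ∈ Finset.range p, (Y i ω - θ i) ^ 4) P :=
    (integrable_const _).add (i4s.const_mul _)
  have j4 : Integrable (fun ω => 1 / s * absRunMax (fun i => Z i ω) p ^ 2) P := iZ.const_mul _
  have j12 : Integrable (fun ω => 3 / 2 * (1 / s ^ 3 * absRunMax (fun i => A i ω) p ^ 2 + s ^ 3) +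
      (1 / s ^ 3 * absRunMax (fun i => B i ω) p ^ 2 + s ^ 3)) P := j1.add j2
  have j34 : Integrable (fun ω => s * (4 * (s ^ 2) ^ 2 + 2 / s ^ 2 * T +
      2 / (s ^ 2) ^ 2 * ∑ i ∈ Finset.range p, (Y i ω - θ i) ^ 4) +
        1 / s * absRunMax (fun i => Z i ω) p ^ 2) P := (j3.const_mul s).add j4
  have hRi : Integrable R P := (j12.add j34).const_mul _
  have hR0 : ∀ ω, 0 ≤ R ω := fun ω => by
    have : 0 ≤ ∑ i ∈ Finset.range p, (Y i ω - θ i) ^ 4 :=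
      Finset.sum_nonneg fun i _ => by positivity
    have hT : 0 ≤ T := Finset.sum_nonneg fun i _ => by positivity
    positivity
  have hle : ∀ ω, supDiscrepancy ν₀ ν₁ ν₂ τ θ Θ p (fun i => Y i ω) ≤ ENNReal.ofReal (R ω) := by
    intro ω
    refine (supDiscrepancy_le ν₀ ν₁ ν₂ h.pos θ Θ hσ hmono _).trans (ENNReal.ofReal_le_ofReal ?_)
    refine mul_le_mul_of_nonneg_left ?_ (by positivity)
    have hsplit : ∀ x y c : ℝ, 0 < c → 2 * x * y ≤ c * x ^ 2 + 1 / c * y ^ 2 := by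
      intro x y c hc
      have : c * x ^ 2 + 1 / c * y ^ 2 - 2 * x * y = 1 / c * (c * x - y) ^ 2 := by field_simp; ring
      nlinarith [show 0 ≤ 1 / c * (c * x - y) ^ 2 by positivity]
    have e1 := hsplit 1 (absRunMax (fun i => A i ω) p) (s ^ 3) (by positivity)
    have e2 := hsplit 1 (absRunMax (fun i => B i ω) p) (s ^ 3) (by positivity)
    have e3 := hsplit (⨆ i : Fin p, |Y i ω|) (absRunMax (fun i => Z i ω) p) s hs
    have e4 := mul_le_mul_of_nonneg_left
      (sq_iSup_abs_le p (fun i => Y i ω) θ (show 0 < s ^ 2 by positivity)) hs.le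
    simp only [A, B, Z, T] at e1 e2 e3 ⊢
    linarith
  calc ∫⁻ ω, supDiscrepancy ν₀ ν₁ ν₂ τ θ Θ p (fun i => Y i ω) ∂P
      ≤ ∫⁻ ω, ENNReal.ofReal (R ω) ∂P := lintegral_mono hle
    _ = ENNReal.ofReal (∫ ω, R ω ∂P) :=
        (ofReal_integral_eq_lintegral_ofReal hRi (ae_of_all _ hR0)).symm
    _ ≤ _ := by
        refine ENNReal.ofReal_le_ofReal ?_
        simp only [R]
        rw [integral_const_mul]
        refine mul_le_mul_of_nonneg_left ?_ (by positivity)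
        rw [integral_add j12 j34, integral_add j1 j2,
          integral_add (j3.const_mul s) j4, integral_const_mul, integral_const_mul,
          integral_const_mul, integral_add (iA.const_mul _) (integrable_const _),
          integral_add (iB.const_mul _) (integrable_const _),
          integral_add (integrable_const _) (i4s.const_mul _), integral_const_mul,
          integral_const_mul, integral_const_mul, integral_finsetSum _ fun i _ => i4 i]
        simp only [integral_const, probReal_univ, one_smul]
        have b1 := mul_le_mul_of_nonneg_left (hA.trans
          (mul_le_mul_of_nonneg_left (h.sum_varError p) (by norm_num)))
          (show 0 ≤ 1 / s ^ 3 by positivity)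
        have b2 := mul_le_mul_of_nonneg_left (hB.trans
          (mul_le_mul_of_nonneg_left (h.sum_dev_mul p) (by norm_num)))
          (show 0 ≤ 1 / s ^ 3 by positivity)
        have b3 := mul_le_mul_of_nonneg_left (hZ.trans
          (mul_le_mul_of_nonneg_left (h.sum_dev_sq p) (by norm_num)))
          (show 0 ≤ 1 / s by positivity)
        have b4 := mul_le_mul_of_nonneg_left (h.sum_dev_four p)
          (show 0 ≤ 2 / (s ^ 2) ^ 2 by positivity)
        have b5 := mul_le_mul_of_nonneg_left (h.sum_mean p) (show 0 ≤ 2 / s ^ 2 by positivity)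
        have b6 := mul_le_mul_of_nonneg_left (add_le_add b4 b5) hs.le
        have c1 : 1 / s ^ 3 * (16 * (C * p)) = 16 * C * p / s ^ 3 := by ring
        have c2 : 1 / s * (16 * (C * p)) = 16 * C * p / s := by ring
        rw [c1] at b1 b2
        rw [c2] at b3
        simp only [T]
        linarith

lemma tendsto_expectedBound (C : ℝ) :
    Tendsto (fun p : ℕ => expectedBound C p ((p : ℝ) ^ (1 / 6 : ℝ))) atTop (𝓝 0) := by
  have h6 : ∀ p : ℕ, ((p : ℝ) ^ (1 / 6 : ℝ)) ^ 6 = p := fun p => by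
    rw [← Real.rpow_natCast, ← Real.rpow_mul (Nat.cast_nonneg p)]
    norm_num
  have hs : Tendsto (fun p : ℕ => ((p : ℝ) ^ (1 / 6 : ℝ))⁻¹) atTop (𝓝 0) :=
    tendsto_inv_atTop_zero.comp
      ((tendsto_rpow_atTop (by norm_num)).comp tendsto_natCast_atTop_atTop)
  have hpoly : Continuous fun u : ℝ => 5 / 2 * (16 * C * u ^ 3 + u ^ 3) +
      ((4 * u + 2 * C * u + 2 * C * u ^ 3) + 16 * C * u) := by fun_prop
  have hlim := (hpoly.tendsto 0).comp hs
  simp only [ne_eq, OfNat.ofNat_ne_zero, not_false_eq_true, zero_pow, mul_zero, add_zero] at hlim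
  refine hlim.congr' ?_
  filter_upwards [eventually_gt_atTop 0] with p hp
  have hp' : (0 : ℝ) < p := Nat.cast_pos.2 hp
  have hspos : 0 < (p : ℝ) ^ (1 / 6 : ℝ) := Real.rpow_pos_of_pos hp' _
  have h := h6 p
  simp only [Function.comp_apply]
  unfold expectedBound
  generalize (p : ℝ) ^ (1 / 6 : ℝ) = s at h hspos ⊢
  rw [← h]
  field_simp

/-- At the scale `s = p ^ (1 / 6)` the expected supremum tends to `0`; Markov's inequality gives
convergence in probability. -/
theorem tendsto_supDiscrepancy {Y : ℕ → Ω → ℝ} {ν₀ ν₁ ν₂ : ℝ} {τ θ : ℕ → ℝ} {C : ℝ}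
    (h : MomentBounds P Y ν₀ ν₁ ν₂ τ θ C) (hind : iIndepFun Y P) (Θ : Set ℝ) :
    (∀ p : ℕ, AEMeasurable (fun ω => supDiscrepancy ν₀ ν₁ ν₂ τ θ Θ p (fun i => Y i ω)) P ∧
      ∫⁻ ω, supDiscrepancy ν₀ ν₁ ν₂ τ θ Θ p (fun i => Y i ω) ∂P ≠ ∞) ∧
    Tendsto (fun p : ℕ => ∫⁻ ω, supDiscrepancy ν₀ ν₁ ν₂ τ θ Θ p (fun i => Y i ω) ∂P)
      atTop (𝓝 0) ∧
    ∀ ε : ℝ, 0 < ε →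
      Tendsto (fun p : ℕ =>
        P {ω | ENNReal.ofReal ε ≤ supDiscrepancy ν₀ ν₁ ν₂ τ θ Θ p (fun i => Y i ω)})
        atTop (𝓝 0) := by
  have hmeas : ∀ p : ℕ,
      AEMeasurable (fun ω => supDiscrepancy ν₀ ν₁ ν₂ τ θ Θ p (fun i => Y i ω)) P := fun p =>
    (measurable_supDiscrepancy ν₀ ν₁ ν₂ h.pos θ Θ p).comp_aemeasurable
      (aemeasurable_pi_lambda _ fun i => (h.memLp i).aestronglyMeasurable.aemeasurable)
  have hlim : Tendsto (fun p : ℕ => ∫⁻ ω, supDiscrepancy ν₀ ν₁ ν₂ τ θ Θ p (fun i => Y i ω) ∂P)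
      atTop (𝓝 0) := by
    have h0 := ENNReal.tendsto_ofReal (tendsto_expectedBound C)
    rw [ENNReal.ofReal_zero] at h0
    refine tendsto_of_tendsto_of_tendsto_of_le_of_le' tendsto_const_nhds h0
      (Eventually.of_forall fun _ => zero_le) ?_
    filter_upwards [eventually_gt_atTop 0] with p hp
    exact lintegral_supDiscrepancy_le h hind Θ p (Real.rpow_pos_of_pos (Nat.cast_pos.2 hp) _)
  refine ⟨fun p => ⟨hmeas p, ne_top_of_le_ne_top ENNReal.ofReal_ne_top
    (lintegral_supDiscrepancy_le h hind Θ p one_pos)⟩, hlim, fun ε hε => ?_⟩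
  have hε' : ENNReal.ofReal ε ≠ 0 := (ENNReal.ofReal_pos.2 hε).ne'
  have h1 := ENNReal.Tendsto.div_const hlim (Or.inr hε')
  rw [ENNReal.zero_div] at h1
  exact tendsto_of_tendsto_of_tendsto_of_le_of_le tendsto_const_nhds h1
    (fun _ => zero_le) fun p => meas_ge_le_lintegral_div (hmeas p) hε' ENNReal.ofReal_ne_top

end Uniform

/-! ### Moment bounds from a quadratic variance function -/

/-- The first moments of an observation from a natural exponential family with quadratic variance
function `V(t) = ν₀ + ν₁ t + ν₂ t ^ 2`, mean `θ` and convolution parameter `τ`. The fourth central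
moment is expressed through `V` and `V'`. -/
structure HasQVFMoments {Ω : Type*} [MeasurableSpace Ω] (P : Measure Ω) (Y : Ω → ℝ)
    (ν₀ ν₁ ν₂ τ θ : ℝ) : Prop where
  memLp : MemLp Y 4 P
  mean : ∫ ω, (Y ω - θ) ∂P = 0
  variance : ∫ ω, (Y ω - θ) ^ 2 ∂P = (ν₀ + ν₁ * θ + ν₂ * θ ^ 2) / τ
  fourth : ∫ ω, (Y ω - θ) ^ 4 ∂P = 3 * (ν₀ + ν₁ * θ + ν₂ * θ ^ 2) ^ 2 / τ ^ 2 +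
    (ν₀ + ν₁ * θ + ν₂ * θ ^ 2) *
      ((ν₁ + 2 * ν₂ * θ) ^ 2 + 2 * ν₂ * (ν₀ + ν₁ * θ + ν₂ * θ ^ 2)) / τ ^ 3

lemma exists_forall_sum_le {g : ℕ → ℝ} (hg : ∀ i, 0 ≤ g i)
    (h : (fun p : ℕ => ∑ i ∈ Finset.range p, g i) =O[atTop] fun p : ℕ => (p : ℝ)) :
    ∃ C : ℝ, ∀ p : ℕ, ∑ i ∈ Finset.range p, g i ≤ C * p := by
  obtain ⟨C, hC⟩ := h.bound
  obtain ⟨N, hN⟩ := eventually_atTop.1 hC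
  have hmono : ∀ {m n : ℕ}, m ≤ n → ∑ i ∈ Finset.range m, g i ≤ ∑ i ∈ Finset.range n, g i :=
    fun hmn => Finset.sum_le_sum_of_subset_of_nonneg (Finset.range_mono hmn) fun i _ _ => hg i
  have h0 : 0 ≤ ∑ i ∈ Finset.range N, g i := Finset.sum_nonneg fun i _ => hg i
  refine ⟨max C (∑ i ∈ Finset.range N, g i), fun p => ?_⟩
  rcases Nat.eq_zero_or_pos p with rfl | hp
  · simp
  have hp1 : (1 : ℝ) ≤ p := by exact_mod_cast hp
  rcases le_total N p with hNp | hpN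
  · have := hN p hNp
    rw [Real.norm_of_nonneg (Finset.sum_nonneg fun i _ => hg i),
      Real.norm_of_nonneg (Nat.cast_nonneg p)] at this
    exact this.trans (mul_le_mul_of_nonneg_right (le_max_left _ _) (Nat.cast_nonneg p))
  · calc ∑ i ∈ Finset.range p, g i ≤ ∑ i ∈ Finset.range N, g i := hmono hpN
      _ ≤ max C (∑ i ∈ Finset.range N, g i) := le_max_right _ _
      _ ≤ _ := le_mul_of_one_le_right (h0.trans (le_max_right _ _)) hp1

section

variable {Ω : Type*} [MeasurableSpace Ω] {P : Measure Ω} [IsProbabilityMeasure P]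

/-- The expansion of `varError` around the mean makes it centred as soon as the variance is
`V(θ) / τ`, and bounds its second moment by `V(θ)²`, `V'(θ)² V(θ)` and the fourth central moment. -/
lemma integral_varError_eq_zero_and_sq_le {Y : Ω → ℝ} {ν₀ ν₁ ν₂ τ θ : ℝ} (hτ : 0 < τ)
    (hτν : τ / 2 ≤ τ + ν₂) (hY : MemLp Y 4 P) (hmean : ∫ ω, (Y ω - θ) ∂P = 0)
    (hvar : ∫ ω, (Y ω - θ) ^ 2 ∂P = (ν₀ + ν₁ * θ + ν₂ * θ ^ 2) / τ) :
    ∫ ω, varError ν₀ ν₁ ν₂ τ θ (Y ω) ∂P = 0 ∧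
    ∫ ω, varError ν₀ ν₁ ν₂ τ θ (Y ω) ^ 2 ∂P ≤
      12 * ((ν₀ + ν₁ * θ + ν₂ * θ ^ 2) ^ 2 / τ ^ 2 +
        (ν₁ + 2 * ν₂ * θ) ^ 2 * (ν₀ + ν₁ * θ + ν₂ * θ ^ 2) / τ ^ 3 +
        ∫ ω, (Y ω - θ) ^ 4 ∂P) := by
  have hZ : MemLp (fun ω => Y ω - θ) 4 P := hY.sub (memLp_const _)
  have i1 : Integrable (fun ω => Y ω - θ) P := hZ.integrable (by norm_num)
  have hsq := memLp_sq_of_four hZ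
  have i2 : Integrable (fun ω => (Y ω - θ) ^ 2) P := hsq.integrable (by norm_num)
  have i4 : Integrable (fun ω => (Y ω - θ) ^ 4) P := by
    simpa only [← pow_mul] using hsq.integrable_sq
  set V := ν₀ + ν₁ * θ + ν₂ * θ ^ 2 with hV
  set W := ν₁ + 2 * ν₂ * θ with hW
  have hpos : 0 < τ + ν₂ := by linarith
  have hexp : ∀ y, varError ν₀ ν₁ ν₂ τ θ y =
      V / (τ + ν₂) + W / (τ + ν₂) * (y - θ) - τ / (τ + ν₂) * (y - θ) ^ 2 := by
    intro y
    unfold varError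
    rw [hV, hW]
    field_simp
    ring
  constructor
  · simp only [hexp]
    have j1 : Integrable (fun ω => V / (τ + ν₂) + W / (τ + ν₂) * (Y ω - θ)) P :=
      (integrable_const _).add (i1.const_mul _)
    rw [integral_sub j1 (i2.const_mul _), integral_add (integrable_const _) (i1.const_mul _),
      integral_const_mul, integral_const_mul, hmean, hvar]
    simp only [integral_const, probReal_univ, one_smul]
    field_simp
    ring
  · have hbound : ∀ y, varError ν₀ ν₁ ν₂ τ θ y ^ 2 ≤
        12 * (V ^ 2 / τ ^ 2 + W ^ 2 / τ ^ 2 * (y - θ) ^ 2 + (y - θ) ^ 4) := by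
      intro y
      have h1 : varError ν₀ ν₁ ν₂ τ θ y =
          τ / (τ + ν₂) * (V / τ + W / τ * (y - θ) - (y - θ) ^ 2) := by
        rw [hexp]; field_simp
      have h2 : τ / (τ + ν₂) ≤ 2 := by rw [div_le_iff₀ hpos]; linarith
      have h3 : 0 ≤ τ / (τ + ν₂) := by positivity
      have h4 : (τ / (τ + ν₂)) ^ 2 ≤ 4 := by nlinarith
      rw [h1, mul_pow]
      calc _ ≤ 4 * (V / τ + W / τ * (y - θ) - (y - θ) ^ 2) ^ 2 :=
            mul_le_mul_of_nonneg_right h4 (sq_nonneg _)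
        _ ≤ 4 * (3 * ((V / τ) ^ 2 + (W / τ * (y - θ)) ^ 2 + ((y - θ) ^ 2) ^ 2)) := by
            nlinarith [sq_nonneg (V / τ - W / τ * (y - θ)), sq_nonneg (V / τ + (y - θ) ^ 2),
              sq_nonneg (W / τ * (y - θ) + (y - θ) ^ 2)]
        _ = _ := by rw [div_pow, mul_pow, div_pow]; ring
    have j1 : Integrable (fun ω => V ^ 2 / τ ^ 2 + W ^ 2 / τ ^ 2 * (Y ω - θ) ^ 2) P :=
      (integrable_const _).add (i2.const_mul _)
    calc ∫ ω, varError ν₀ ν₁ ν₂ τ θ (Y ω) ^ 2 ∂P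
        ≤ ∫ ω, 12 * (V ^ 2 / τ ^ 2 + W ^ 2 / τ ^ 2 * (Y ω - θ) ^ 2 + (Y ω - θ) ^ 4) ∂P :=
          integral_mono (memLp_varError hY _ _ _ _ _).integrable_sq
            ((j1.add i4).const_mul 12) fun ω => hbound _
      _ = _ := by
          rw [integral_const_mul, integral_add j1 i4,
            integral_add (integrable_const _) (i2.const_mul _), integral_const_mul, hvar]
          simp only [integral_const, probReal_univ, one_smul]
          field_simp

/-- Moment bounds in terms of a sequence `g` with `∑_{i < p} g i = O(p)` that dominates the fourth
central moments and the relevant functions of the means. -/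
lemma exists_momentBounds {Y : ℕ → Ω → ℝ} {ν₀ ν₁ ν₂ : ℝ} {τ θ g : ℕ → ℝ} {c C K : ℝ} (hc : 0 < c)
    (hK : 0 ≤ K) (hτ : ∀ i, c ≤ τ i)
    (hτν : ∀ i, τ i / 2 ≤ τ i + ν₂) (hY : ∀ i, MemLp (Y i) 4 P)
    (hmean : ∀ i, ∫ ω, (Y i ω - θ i) ∂P = 0)
    (hvar : ∀ i, ∫ ω, (Y i ω - θ i) ^ 2 ∂P = (ν₀ + ν₁ * θ i + ν₂ * θ i ^ 2) / τ i)
    (hfour : ∀ i, ∫ ω, (Y i ω - θ i) ^ 4 ∂P ≤ K * g i)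
    (hV1 : ∀ i, (ν₀ + ν₁ * θ i + ν₂ * θ i ^ 2) * (1 + θ i ^ 2) ≤ K * g i)
    (hV2 : ∀ i, (ν₀ + ν₁ * θ i + ν₂ * θ i ^ 2) ^ 2 ≤ K * g i)
    (hV3 : ∀ i, (ν₁ + 2 * ν₂ * θ i) ^ 2 * (ν₀ + ν₁ * θ i + ν₂ * θ i ^ 2) ≤ K * g i)
    (hθ : ∀ i, |θ i| ^ 3 ≤ K * g i) (hg : ∀ p : ℕ, ∑ i ∈ Finset.range p, g i ≤ C * p) :
    ∃ C', MomentBounds P Y ν₀ ν₁ ν₂ τ θ C' := by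
  have hτ0 : ∀ i, 0 < τ i := fun i => hc.trans_le (hτ i)
  have hKg : ∀ i, 0 ≤ K * g i := fun i => (by positivity : 0 ≤ |θ i| ^ 3).trans (hθ i)
  have hV0 : ∀ i, 0 ≤ ν₀ + ν₁ * θ i + ν₂ * θ i ^ 2 := fun i => by
    have h1 : 0 ≤ ∫ ω, (Y i ω - θ i) ^ 2 ∂P := integral_nonneg fun ω => sq_nonneg _
    rw [hvar, le_div_iff₀ (hτ0 i)] at h1
    simpa using h1
  have hc1 : ∀ i, 1 / τ i ≤ 1 / c := fun i => one_div_le_one_div_of_le hc (hτ i)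
  have hc2 : ∀ i, 1 / τ i ^ 2 ≤ 1 / c ^ 2 := fun i =>
    one_div_le_one_div_of_le (by positivity) (pow_le_pow_left₀ hc.le (hτ i) 2)
  have hc3 : ∀ i, 1 / τ i ^ 3 ≤ 1 / c ^ 3 := fun i =>
    one_div_le_one_div_of_le (by positivity) (pow_le_pow_left₀ hc.le (hτ i) 3)
  have hdiv : ∀ {x d t : ℝ} {i : ℕ}, x ≤ K * g i → 0 ≤ 1 / t → 1 / t ≤ d →
      x / t ≤ d * (K * g i) := by
    intro x d t i hx ht htd
    rw [div_eq_mul_one_div, mul_comm]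
    exact (mul_le_mul_of_nonneg_left hx ht).trans (mul_le_mul_of_nonneg_right htd (hKg i))
  let D : ℝ := 12 * (1 / c ^ 2 + 1 / c ^ 3 + 1) + 1 / c + 1
  have h1c : 0 < 1 / c := by positivity
  have h2c : 0 < 1 / c ^ 2 := by positivity
  have h3c : 0 < 1 / c ^ 3 := by positivity
  have hD0 : 0 ≤ D := by positivity
  have hsum : ∀ {x : ℕ → ℝ}, (∀ i, x i ≤ D * (K * g i)) →
      ∀ p : ℕ, ∑ i ∈ Finset.range p, x i ≤ D * K * C * p := by
    intro x hx p
    calc ∑ i ∈ Finset.range p, x i ≤ ∑ i ∈ Finset.range p, D * (K * g i) :=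
          Finset.sum_le_sum fun i _ => hx i
      _ = D * K * ∑ i ∈ Finset.range p, g i := by
          rw [Finset.mul_sum]; exact Finset.sum_congr rfl fun i _ => by ring
      _ ≤ D * K * (C * p) := mul_le_mul_of_nonneg_left (hg p) (mul_nonneg hD0 hK)
      _ = _ := by ring
  have hD : ∀ {x d : ℝ} {i : ℕ}, x ≤ d * (K * g i) → d ≤ D → x ≤ D * (K * g i) :=
    fun h1 h2 => h1.trans (mul_le_mul_of_nonneg_right h2 (hKg _))
  have hVθ : ∀ i, (ν₀ + ν₁ * θ i + ν₂ * θ i ^ 2) * θ i ^ 2 ≤ K * g i := fun i => by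
    nlinarith [hV1 i, hV0 i]
  have hV : ∀ i, ν₀ + ν₁ * θ i + ν₂ * θ i ^ 2 ≤ K * g i := fun i => by
    nlinarith [hV1 i, hV0 i, mul_nonneg (hV0 i) (sq_nonneg (θ i))]
  refine ⟨D * K * C, hτ0, hY, hmean,
    fun i => (integral_varError_eq_zero_and_sq_le (hτ0 i) (hτν i) (hY i) (hmean i) (hvar i)).1,
    hsum fun i => ?_, hsum fun i => ?_, hsum fun i => ?_, hsum fun i => ?_, hsum fun i => ?_⟩
  · refine (integral_varError_eq_zero_and_sq_le (hτ0 i) (hτν i) (hY i) (hmean i)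
      (hvar i)).2.trans ?_
    have e1 := hdiv (hV2 i) (by have := hτ0 i; positivity) (hc2 i)
    have e2 := hdiv (hV3 i) (by have := hτ0 i; positivity) (hc3 i)
    refine hD (d := 12 * (1 / c ^ 2 + 1 / c ^ 3 + 1)) ?_ (by simp only [D]; linarith)
    linarith [hfour i]
  · have e1 : ∫ ω, ((Y i ω - θ i) * θ i) ^ 2 ∂P =
        (ν₀ + ν₁ * θ i + ν₂ * θ i ^ 2) * θ i ^ 2 / τ i := by
      simp only [mul_pow]
      rw [integral_mul_const, hvar]
      ring
    rw [e1]
    exact hD (hdiv (hVθ i) (by have := hτ0 i; positivity) (hc1 i)) (by simp only [D]; linarith)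
  · rw [hvar]
    exact hD (hdiv (hV i) (by have := hτ0 i; positivity) (hc1 i)) (by simp only [D]; linarith)
  · exact hD (d := 1) (by rw [one_mul]; exact hfour i) (by simp only [D]; linarith)
  · exact hD (d := 1) (by rw [one_mul]; exact hθ i) (by simp only [D]; linarith)

/-- For `ν₂ ≥ 0` and convolution parameters bounded away from `0` the exact fourth central moment
is dominated by `V²` and `V'² V`. -/
lemma exists_momentBounds_of_hasQVFMoments {Y : ℕ → Ω → ℝ} {ν₀ ν₁ ν₂ : ℝ} {τ θ g : ℕ → ℝ}
    {c C K : ℝ} (hc : 0 < c) (hK : 0 ≤ K) (hν₂ : 0 ≤ ν₂) (hτ : ∀ i, c ≤ τ i)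
    (hY : ∀ i, HasQVFMoments P (Y i) ν₀ ν₁ ν₂ (τ i) (θ i))
    (hV1 : ∀ i, (ν₀ + ν₁ * θ i + ν₂ * θ i ^ 2) * (1 + θ i ^ 2) ≤ K * g i)
    (hV2 : ∀ i, (ν₀ + ν₁ * θ i + ν₂ * θ i ^ 2) ^ 2 ≤ K * g i)
    (hV3 : ∀ i, (ν₁ + 2 * ν₂ * θ i) ^ 2 * (ν₀ + ν₁ * θ i + ν₂ * θ i ^ 2) ≤ K * g i)
    (hθ : ∀ i, |θ i| ^ 3 ≤ K * g i) (hg : ∀ p : ℕ, ∑ i ∈ Finset.range p, g i ≤ C * p) :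
    ∃ C', MomentBounds P Y ν₀ ν₁ ν₂ τ θ C' := by
  have hτ0 : ∀ i, 0 < τ i := fun i => hc.trans_le (hτ i)
  have hKg : ∀ i, 0 ≤ K * g i := fun i => (by positivity : 0 ≤ |θ i| ^ 3).trans (hθ i)
  let L : ℝ := 1 + 3 / c ^ 2 + (1 + 2 * ν₂) / c ^ 3
  have hL : 1 ≤ L := by
    have : 0 ≤ 3 / c ^ 2 + (1 + 2 * ν₂) / c ^ 3 := by positivity
    simp only [L]; linarith
  have hup : ∀ {x : ℝ} {i : ℕ}, x ≤ K * g i → x ≤ L * K * g i := fun {x i} h => by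
    rw [mul_assoc]
    exact h.trans (le_mul_of_one_le_left (hKg i) hL)
  refine exists_momentBounds (K := L * K) hc (mul_nonneg (by linarith) hK) hτ
    (fun i => by linarith [hτ0 i]) (fun i => (hY i).memLp) (fun i => (hY i).mean)
    (fun i => (hY i).variance) (fun i => ?_) (fun i => hup (hV1 i)) (fun i => hup (hV2 i))
    (fun i => hup (hV3 i)) (fun i => hup (hθ i)) hg
  rw [(hY i).fourth]
  have h2 := hV2 i
  have h3 := hV3 i
  generalize ν₀ + ν₁ * θ i + ν₂ * θ i ^ 2 = V at h2 h3 ⊢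
  generalize (ν₁ + 2 * ν₂ * θ i) ^ 2 = W at h3 ⊢
  have e1 : 3 * V ^ 2 / τ i ^ 2 ≤ 3 / c ^ 2 * (K * g i) := by
    calc 3 * V ^ 2 / τ i ^ 2 ≤ 3 * (K * g i) / c ^ 2 := by
          have := hτ i
          have := hKg i
          gcongr
      _ = _ := by ring
  have e2 : V * (W + 2 * ν₂ * V) / τ i ^ 3 ≤ (1 + 2 * ν₂) / c ^ 3 * (K * g i) := by
    have e3 : V * (W + 2 * ν₂ * V) ≤ (1 + 2 * ν₂) * (K * g i) := by
      nlinarith [mul_le_mul_of_nonneg_left h2 hν₂]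
    calc V * (W + 2 * ν₂ * V) / τ i ^ 3 ≤ (1 + 2 * ν₂) * (K * g i) / c ^ 3 := by
          have := hτ i
          have := hKg i
          gcongr
      _ = _ := by ring
  simp only [L]
  nlinarith [hKg i]

end

/-! ### From raw moments to central moments -/

section Raw

variable {ι : Type*} [MeasurableSpace ι] {ν : Measure ι}

lemma integrable_pow_of_le_four [IsFiniteMeasure ν] {X : ι → ℝ} (hX : AEStronglyMeasurable X ν)
    (h4 : Integrable (fun x => X x ^ 4) ν) {k : ℕ} (hk : k ≤ 4) :
    Integrable (fun x => X x ^ k) ν := by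
  refine (h4.add (integrable_const (1 : ℝ))).mono' (hX.pow k) (ae_of_all _ fun x => ?_)
  rw [norm_pow, Real.norm_eq_abs, Pi.add_apply]
  have h0 := abs_nonneg (X x)
  have h5 : X x ^ 4 = |X x| ^ 4 := (Even.pow_abs (by decide) _).symm
  rw [h5]
  rcases le_total |X x| 1 with h | h
  · linarith [pow_le_one₀ (n := k) h0 h, pow_nonneg h0 4]
  · linarith [pow_le_pow_right₀ h hk]

lemma integral_poly_four [IsProbabilityMeasure ν] {X : ι → ℝ} (hX : AEStronglyMeasurable X ν)
    (h4 : Integrable (fun x => X x ^ 4) ν) (c₀ c₁ c₂ c₃ c₄ : ℝ) :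
    ∫ x, (c₀ + c₁ * X x + c₂ * X x ^ 2 + c₃ * X x ^ 3 + c₄ * X x ^ 4) ∂ν =
      c₀ + c₁ * ∫ x, X x ∂ν + c₂ * ∫ x, X x ^ 2 ∂ν + c₃ * ∫ x, X x ^ 3 ∂ν +
        c₄ * ∫ x, X x ^ 4 ∂ν := by
  have i1 : Integrable X ν := by
    simpa using integrable_pow_of_le_four hX h4 (show 1 ≤ 4 by norm_num)
  have i2 := integrable_pow_of_le_four hX h4 (show 2 ≤ 4 by norm_num)
  have i3 := integrable_pow_of_le_four hX h4 (show 3 ≤ 4 by norm_num)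
  have j1 : Integrable (fun x => c₀ + c₁ * X x) ν := (integrable_const _).add (i1.const_mul _)
  have j2 : Integrable (fun x => c₀ + c₁ * X x + c₂ * X x ^ 2) ν := j1.add (i2.const_mul _)
  have j3 : Integrable (fun x => c₀ + c₁ * X x + c₂ * X x ^ 2 + c₃ * X x ^ 3) ν :=
    j2.add (i3.const_mul _)
  rw [integral_add j3 (h4.const_mul _), integral_add j2 (i3.const_mul _),
    integral_add j1 (i2.const_mul _), integral_add (integrable_const _) (i1.const_mul _)]
  simp [integral_const_mul]

/-- The moments of `Y = X / τ` from those of `X`; these are the raw moments of a variable whose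
cumulants are `τ θ`, `τ V`, `τ V V'` and `τ V (V'² + 2 ν₂ V)`. -/
lemma hasQVFMoments_of_raw {Ω : Type*} [MeasurableSpace Ω] {P : Measure Ω} [IsProbabilityMeasure P]
    {Y : Ω → ℝ} {X : ι → ℝ} {ν₀ ν₁ ν₂ τ θ V W : ℝ} (hX : Measurable X) (hτ : τ ≠ 0)
    (hlaw : HasLaw Y (ν.map fun x => X x / τ) P) (h4 : Integrable (fun x => X x ^ 4) ν)
    (hV : V = ν₀ + ν₁ * θ + ν₂ * θ ^ 2) (hW : W = ν₁ + 2 * ν₂ * θ)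
    (m1 : ∫ x, X x ∂ν = τ * θ) (m2 : ∫ x, X x ^ 2 ∂ν = (τ * θ) ^ 2 + τ * V)
    (m3 : ∫ x, X x ^ 3 ∂ν = (τ * θ) ^ 3 + 3 * (τ * θ) * (τ * V) + τ * V * W)
    (m4 : ∫ x, X x ^ 4 ∂ν = (τ * θ) ^ 4 + 6 * (τ * θ) ^ 2 * (τ * V) + 4 * (τ * θ) * (τ * V * W) +
      3 * (τ * V) ^ 2 + τ * V * (W ^ 2 + 2 * ν₂ * V)) :
    HasQVFMoments P Y ν₀ ν₁ ν₂ τ θ := by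
  have hg : Measurable fun x => X x / τ := hX.div_const τ
  have hprob : IsProbabilityMeasure ν := by
    rw [← Measure.isProbabilityMeasure_map_iff hg.aemeasurable, ← hlaw.isProbabilityMeasure_iff]
    infer_instance
  have hXm : AEStronglyMeasurable X ν := hX.aestronglyMeasurable
  have hint : ∀ f : ℝ → ℝ, Measurable f → ∫ ω, f (Y ω) ∂P = ∫ x, f (X x / τ) ∂ν := by
    intro f hf
    have := hlaw.integral_comp (f := f) hf.aestronglyMeasurable
    simp only [Function.comp_def] at this
    rw [this, integral_map hg.aemeasurable hf.aestronglyMeasurable]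
  refine ⟨?_, ?_, ?_, ?_⟩
  · have hX4 : MemLp X 4 ν := by
      rw [← integrable_norm_rpow_iff hXm (by norm_num) (by norm_num)]
      refine h4.congr (ae_of_all _ fun x => ?_)
      have : (4 : ℝ≥0∞).toReal = ((4 : ℕ) : ℝ) := by norm_num
      simp only [this, Real.rpow_natCast, Real.norm_eq_abs]
      exact (Even.pow_abs (by decide) _).symm
    have hX4' : MemLp (fun x => X x / τ) 4 ν := by
      simpa only [div_eq_mul_inv] using hX4.mul_const τ⁻¹
    have h5 : MemLp id 4 (ν.map fun x => X x / τ) :=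
      (memLp_map_measure_iff aestronglyMeasurable_id hg.aemeasurable).2 hX4'
    rw [← hlaw.map_eq] at h5
    exact (memLp_map_measure_iff aestronglyMeasurable_id hlaw.aemeasurable).1 h5
  · rw [hint (fun y => y - θ) (by fun_prop)]
    have := integral_poly_four hXm h4 (-θ) (1 / τ) 0 0 0
    rw [m1] at this
    convert this using 1
    · congr 1; funext x; ring
    · field_simp; ring
  · rw [hint (fun y => (y - θ) ^ 2) (by fun_prop), ← hV]
    have := integral_poly_four hXm h4 (θ ^ 2) (-2 * θ / τ) (1 / τ ^ 2) 0 0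
    rw [m1, m2] at this
    convert this using 1
    · congr 1; funext x; field_simp; ring
    · field_simp; ring
  · rw [hint (fun y => (y - θ) ^ 4) (by fun_prop), ← hV, ← hW]
    have := integral_poly_four hXm h4 (θ ^ 4) (-4 * θ ^ 3 / τ) (6 * θ ^ 2 / τ ^ 2)
      (-4 * θ / τ ^ 3) (1 / τ ^ 4)
    rw [m1, m2, m3, m4] at this
    convert this using 1
    · congr 1; funext x; field_simp; ring
    · field_simp; ring

end Raw

/-! ### Distributions on `ℕ` with a Panjer recursion -/

/-- Weights with `(k + 1) w (k + 1) = (a + b k) w k` decrease geometrically, so that all moments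
exist. -/
lemma summable_panjer_mul_pow {w : ℕ → ℝ} {a b : ℝ} (ha : 0 < a) (hb0 : 0 ≤ b) (hb1 : b < 1)
    (hw : ∀ k, 0 < w k) (hrec : ∀ k : ℕ, w (k + 1) * (k + 1) = (a + b * k) * w k) (j : ℕ) :
    Summable fun k : ℕ => w k * (k : ℝ) ^ j := by
  refine summable_of_ratio_test_tendsto_lt_one hb1 ?_ ?_
  · filter_upwards [eventually_gt_atTop 0] with k hk
    have : (0 : ℝ) < k := by exact_mod_cast hk
    have := hw k
    positivity
  · have h1 := tendsto_add_mul_div_add_mul_atTop_nhds a 1 b (one_ne_zero : (1 : ℝ) ≠ 0)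
    have h2 := tendsto_add_mul_div_add_mul_atTop_nhds 1 0 1 (one_ne_zero : (1 : ℝ) ≠ 0)
    have h3 := h1.mul (h2.pow j)
    simp only [div_one, one_pow, mul_one] at h3
    refine h3.congr' ?_
    filter_upwards [eventually_gt_atTop 0] with k hk
    have hk' : (0 : ℝ) < k := by exact_mod_cast hk
    have hwk := hw k
    have hwk' := hw (k + 1)
    rw [Real.norm_of_nonneg (by positivity), Real.norm_of_nonneg (by positivity)]
    have h5 : w (k + 1) = (a + b * k) * w k / (k + 1) := by
      rw [eq_div_iff (by positivity), hrec]
    rw [h5]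
    push_cast
    simp only [one_mul, zero_add, div_pow, add_comm (1 : ℝ)]
    field_simp

lemma cast_descFactorial_succ (k j : ℕ) :
    (k.descFactorial (j + 1) : ℝ) = (k - j) * k.descFactorial j := by
  rcases le_or_gt j k with h | h
  · rw [Nat.descFactorial_succ]
    push_cast [h]
    ring
  · simp [Nat.descFactorial_of_lt h]

/-- The factorial moments of a distribution with a Panjer recursion. -/
lemma hasSum_panjer_descFactorial {w : ℕ → ℝ} {a b : ℝ} (ha : 0 < a) (hb0 : 0 ≤ b) (hb1 : b < 1)
    (hw : ∀ k, 0 < w k) (hrec : ∀ k : ℕ, w (k + 1) * (k + 1) = (a + b * k) * w k)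
    (hsum : HasSum w 1) (j : ℕ) :
    HasSum (fun k : ℕ => w k * (k.descFactorial j : ℝ))
      (∏ i ∈ Finset.range j, (a + b * i) / (1 - b)) := by
  have hS : ∀ j, Summable fun k : ℕ => w k * (k.descFactorial j : ℝ) := fun j =>
    (summable_panjer_mul_pow ha hb0 hb1 hw hrec j).of_nonneg_of_le
      (fun k => mul_nonneg (hw k).le (Nat.cast_nonneg _))
      fun k => mul_le_mul_of_nonneg_left (by exact_mod_cast Nat.descFactorial_le_pow k j) (hw k).le
  induction j with
  | zero => simpa using hsum
  | succ j ih =>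
    have h1 : HasSum (fun k : ℕ => w k * (k.descFactorial (j + 1) : ℝ))
        (∑' k : ℕ, w k * (k.descFactorial (j + 1) : ℝ)) := (hS (j + 1)).hasSum
    set T := ∑' k : ℕ, w k * (k.descFactorial (j + 1) : ℝ) with hT
    have h2 := (hasSum_nat_add_iff' 1).2 h1
    simp only [Finset.range_one, Finset.sum_singleton, Nat.zero_descFactorial_succ, Nat.cast_zero,
      mul_zero, sub_zero] at h2
    have h3 := (ih.mul_left (a + b * j)).add (h1.mul_left b)
    have h4 : (fun k : ℕ => w (k + 1) * ((k + 1).descFactorial (j + 1) : ℝ)) = fun k : ℕ =>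
        (a + b * j) * (w k * (k.descFactorial j : ℝ)) +
          b * (w k * (k.descFactorial (j + 1) : ℝ)) := by
      funext k
      rw [Nat.succ_descFactorial_succ, cast_descFactorial_succ]
      push_cast
      linear_combination (k.descFactorial j : ℝ) * hrec k
    rw [h4] at h2
    have h6 := h2.unique h3
    have h7 : T = ∏ i ∈ Finset.range (j + 1), (a + b * i) / (1 - b) := by
      rw [Finset.prod_range_succ]
      have : 1 - b ≠ 0 := by linarith
      field_simp
      linear_combination h6
    rwa [h7] at h1

lemma integrable_and_integral_sum_dirac {w f : ℕ → ℝ} {S : ℝ} (hw : ∀ k, 0 ≤ w k)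
    (hf : ∀ k, 0 ≤ f k) (h : HasSum (fun k => w k * f k) S) :
    Integrable f (Measure.sum fun k : ℕ => ENNReal.ofReal (w k) • Measure.dirac k) ∧
      ∫ k, f k ∂(Measure.sum fun k : ℕ => ENNReal.ofReal (w k) • Measure.dirac k) = S := by
  have h1 : Summable fun k => (ENNReal.ofReal (w k)).toReal * ‖f k‖ := by
    simpa only [ENNReal.toReal_ofReal (hw _), Real.norm_of_nonneg (hf _)] using h.summable
  refine ⟨(integrable_sum_dirac_iff (by simp)).2 h1, ?_⟩
  rw [integral_sum_dirac_eq_tsum (by simp) h1, ← h.tsum_eq]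
  simp only [ENNReal.toReal_ofReal (hw _), smul_eq_mul]

/-- The Panjer class (here Poisson and negative binomial) has the moments of a family with variance
function `θ + b / a * τ * θ ^ 2`, where `τ * θ = a / (1 - b)`. -/
lemma hasQVFMoments_of_panjer {Ω : Type*} [MeasurableSpace Ω] {P : Measure Ω}
    [IsProbabilityMeasure P] {Y : Ω → ℝ} {w : ℕ → ℝ} {a b τ θ ν₂ : ℝ} (ha : 0 < a) (hb0 : 0 ≤ b)
    (hb1 : b < 1) (hw : ∀ k, 0 < w k)
    (hrec : ∀ k : ℕ, w (k + 1) * (k + 1) = (a + b * k) * w k) (hτ : τ ≠ 0)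
    (hθ : a = τ * θ * (1 - b)) (hν₂ : b = ν₂ * θ * (1 - b))
    (hlaw : HasLaw Y ((Measure.sum fun k : ℕ => ENNReal.ofReal (w k) • Measure.dirac k).map
      fun k : ℕ => (k : ℝ) / τ) P) :
    HasQVFMoments P Y 0 1 ν₂ τ θ := by
  set ν := Measure.sum fun k : ℕ => ENNReal.ofReal (w k) • Measure.dirac k with hν
  have hprob : IsProbabilityMeasure ν := by
    rw [← Measure.isProbabilityMeasure_map_iff (f := fun k : ℕ => (k : ℝ) / τ) (by fun_prop),
      ← hlaw.isProbabilityMeasure_iff]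
    infer_instance
  have hw0 : ∀ k, 0 ≤ w k := fun k => (hw k).le
  have hsum : HasSum w 1 := by
    have h0 : Summable w := by
      simpa using summable_panjer_mul_pow ha hb0 hb1 hw hrec 0
    have h1 := (integrable_and_integral_sum_dirac hw0 (f := fun _ => 1) (S := ∑' k, w k)
      (fun _ => zero_le_one) (by simpa using h0.hasSum)).2
    rw [← hν] at h1
    simp only [integral_const, probReal_univ, one_smul] at h1
    rw [h1]
    exact h0.hasSum
  have hF := hasSum_panjer_descFactorial ha hb0 hb1 hw hrec hsum
  have hb : 1 - b ≠ 0 := by linarith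
  have hfac : ∀ i : ℝ, (a + b * i) / (1 - b) = (τ + ν₂ * i) * θ := fun i => by
    rw [div_eq_iff hb]
    linear_combination hθ + i * hν₂
  have f1 := hF 1
  have f2 := hF 2
  have f3 := hF 3
  have f4 := hF 4
  simp only [Finset.prod_range_succ, Finset.prod_range_zero, hfac, cast_descFactorial_succ,
    Nat.descFactorial_zero, Nat.cast_zero, Nat.cast_one, Nat.cast_ofNat, mul_zero, add_zero,
    sub_zero, mul_one, one_mul] at f1 f2 f3 f4
  have g1 := integrable_and_integral_sum_dirac hw0 (f := fun k => (k : ℝ))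
    (fun k => by positivity) f1
  have g2 := integrable_and_integral_sum_dirac hw0 (f := fun k => (k : ℝ) ^ 2)
    (fun k => by positivity) (by
      convert! f2.add f1 using 1
      funext k; ring)
  have g3 := integrable_and_integral_sum_dirac hw0 (f := fun k => (k : ℝ) ^ 3)
    (fun k => by positivity) (by
      convert! (f3.add (f2.mul_left 3)).add f1 using 1
      funext k; ring)
  have g4 := integrable_and_integral_sum_dirac hw0 (f := fun k => (k : ℝ) ^ 4)
    (fun k => by positivity) (by
      convert! ((f4.add (f3.mul_left 6)).add (f2.mul_left 7)).add f1 using 1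
      funext k; ring)
  refine hasQVFMoments_of_raw (X := fun k : ℕ => (k : ℝ)) (by fun_prop) hτ hlaw g4.1 rfl rfl
    g1.2 (g2.2.trans ?_) (g3.2.trans ?_) (g4.2.trans ?_) <;> ring

lemma hasQVFMoments_poisson {Ω : Type*} [MeasurableSpace Ω] {P : Measure Ω}
    [IsProbabilityMeasure P] {Y : Ω → ℝ} {τ θ : ℝ} (hτ : 0 < τ) (hτθ : 0 < τ * θ)
    (hlaw : HasLaw Y ((poissonMeasure (τ * θ).toNNReal).map fun k : ℕ => (k : ℝ) / τ) P) :
    HasQVFMoments P Y 0 1 0 τ θ := by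
  have hr : ((τ * θ).toNNReal : ℝ) = τ * θ := Real.coe_toNNReal _ hτθ.le
  rw [poissonMeasure, hr] at hlaw
  refine hasQVFMoments_of_panjer hτθ le_rfl zero_lt_one (fun k => by positivity) (fun k => ?_)
    hτ.ne' (by ring) (by ring) hlaw
  rw [Nat.factorial_succ, pow_succ]
  push_cast
  field_simp
  ring

lemma hasQVFMoments_negBinomial {Ω : Type*} [MeasurableSpace Ω] {P : Measure Ω}
    [IsProbabilityMeasure P] {Y : Ω → ℝ} {r q : ℝ} (hr : 0 < r) (hq : q ∈ Set.Ioo (0 : ℝ) 1)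
    (hlaw : HasLaw Y ((negBinomialMeasure r q).map fun k : ℕ => (k : ℝ) / r) P) :
    HasQVFMoments P Y 0 1 1 r (q / (1 - q)) := by
  have hq0 := hq.1
  have hq1 : 0 < 1 - q := by linarith [hq.2]
  have hw : ∀ k : ℕ, 0 < Real.Gamma (r + k) / (Real.Gamma r * (k.factorial : ℝ)) *
      (1 - q) ^ r * q ^ k := fun k => by
    have h1 := Real.Gamma_pos_of_pos hr
    have h2 := Real.Gamma_pos_of_pos (show 0 < r + k by positivity)
    have h3 := Real.rpow_pos_of_pos hq1 r
    positivity
  refine hasQVFMoments_of_panjer (a := q * r) (b := q) (by positivity) hq0.le hq.2 hw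
    (fun k => ?_) hr.ne' (by field_simp) (by field_simp) hlaw
  have h4 : Real.Gamma (r + (k + 1 : ℕ)) = (r + k) * Real.Gamma (r + k) := by
    rw [← Real.Gamma_add_one (by positivity)]
    push_cast
    ring_nf
  have h1 := (Real.Gamma_pos_of_pos hr).ne'
  rw [h4, Nat.factorial_succ, pow_succ]
  push_cast
  field_simp

/-! ### The gamma distribution -/

/-- Multiplication by `x ^ k` turns a gamma density into a multiple of another one. -/
lemma integrable_and_integral_pow_gammaMeasure {a l : ℝ} (ha : 0 < a) (hl : 0 < l) (k : ℕ) :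
    Integrable (fun x => x ^ k) (gammaMeasure a (1 / l)) ∧
      ∫ x, x ^ k ∂(gammaMeasure a (1 / l)) = l ^ k * Real.Gamma (a + k) / Real.Gamma a := by
  have hb : 0 < 1 / l := by positivity
  have hak : 0 < a + k := by positivity
  have hΓ := Real.Gamma_pos_of_pos ha
  have hΓk := Real.Gamma_pos_of_pos hak
  have hdens : ∀ᵐ x : ℝ, gammaPDFReal a (1 / l) x * x ^ k =
      l ^ k * Real.Gamma (a + k) / Real.Gamma a * gammaPDFReal (a + k) (1 / l) x := by
    have h0 : ∀ᵐ x : ℝ, x ≠ 0 := by simp [ae_iff, measure_singleton]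
    filter_upwards [h0] with x hx
    unfold gammaPDFReal
    split_ifs with h
    · have hx' : 0 < x := lt_of_le_of_ne h (Ne.symm hx)
      have e1 : x ^ (a + k - 1) = x ^ (a - 1) * x ^ k := by
        rw [← Real.rpow_natCast, ← Real.rpow_add hx']; ring_nf
      have e2 : (1 / l) ^ (a + k) = (1 / l) ^ a * (1 / l ^ k) := by
        rw [Real.rpow_add hb, Real.rpow_natCast, one_div_pow]
      rw [e1, e2]
      field_simp
    · simp
  have hprob : ∀ {a' : ℝ}, 0 < a' → Integrable (gammaPDFReal a' (1 / l)) ∧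
      ∫ x, gammaPDFReal a' (1 / l) x = 1 := by
    intro a' ha'
    have h1 := lintegral_gammaPDF_eq_one ha' hb
    have hnn : 0 ≤ᵐ[volume] gammaPDFReal a' (1 / l) := ae_of_all _ (gammaPDFReal_nonneg ha' hb)
    have hm := (measurable_gammaPDFReal a' (1 / l)).aestronglyMeasurable (μ := volume)
    refine ⟨(lintegral_ofReal_ne_top_iff_integrable hm hnn).1 ?_, ?_⟩
    · change ∫⁻ x, gammaPDF a' (1 / l) x ≠ ∞
      rw [h1]; simp
    · rw [integral_eq_lintegral_of_nonneg_ae hnn hm]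
      change (∫⁻ x, gammaPDF a' (1 / l) x).toReal = 1
      rw [h1, ENNReal.toReal_one]
  have hmeas : Measurable (gammaPDF a (1 / l)) :=
    (measurable_gammaPDFReal a (1 / l)).ennreal_ofReal
  have hto : ∀ x, (gammaPDF a (1 / l) x).toReal = gammaPDFReal a (1 / l) x := fun x =>
    ENNReal.toReal_ofReal (gammaPDFReal_nonneg ha hb x)
  constructor
  · rw [gammaMeasure, integrable_withDensity_iff_integrable_smul₀' hmeas.aemeasurable
      (ae_of_all _ fun x => ENNReal.ofReal_lt_top)]
    simp only [hto, smul_eq_mul]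
    exact ((hprob hak).1.const_mul _).congr (hdens.mono fun x hx => hx.symm)
  · rw [gammaMeasure, integral_withDensity_eq_integral_toReal_smul hmeas
      (ae_of_all _ fun x => ENNReal.ofReal_lt_top)]
    simp only [hto, smul_eq_mul]
    rw [integral_congr_ae hdens, integral_const_mul, (hprob hak).2, mul_one]

lemma hasQVFMoments_gamma {Ω : Type*} [MeasurableSpace Ω] {P : Measure Ω}
    [IsProbabilityMeasure P] {Y : Ω → ℝ} {α τ l : ℝ} (hα : 0 < α) (hτ : 0 < τ) (hl : 0 < l)
    (hlaw : HasLaw Y ((gammaMeasure (τ * α) (1 / l)).map fun x : ℝ => x / τ) P) :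
    HasQVFMoments P Y 0 0 (1 / α) τ (α * l) := by
  have ha : 0 < τ * α := by positivity
  have hm := integrable_and_integral_pow_gammaMeasure ha hl
  have hΓ := (Real.Gamma_pos_of_pos ha).ne'
  have hG : ∀ k : ℕ, Real.Gamma (τ * α + (k + 1 : ℕ)) =
      (τ * α + k) * Real.Gamma (τ * α + k) := fun k => by
    rw [← Real.Gamma_add_one (by positivity)]
    push_cast
    ring_nf
  have g1 := (hm 1).2
  have g2 := (hm 2).2
  have g3 := (hm 3).2
  have g4 := (hm 4).2
  rw [hG 3, hG 2, hG 1, hG 0] at g4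
  rw [hG 2, hG 1, hG 0] at g3
  rw [hG 1, hG 0] at g2
  rw [hG 0] at g1
  simp only [pow_one, Nat.cast_zero, Nat.cast_one, Nat.cast_ofNat, add_zero] at g1 g2 g3 g4
  refine hasQVFMoments_of_raw (X := fun x : ℝ => x) measurable_id hτ.ne' hlaw (hm 4).1 rfl rfl
    (g1.trans ?_) (g2.trans ?_) (g3.trans ?_) (g4.trans ?_) <;> field_simp <;> ring

/-! ### The binomial distribution -/

/-- The mean and variance of the binomial distribution, read off from Bernstein polynomials. -/
lemma integral_binomial_dev (n : ℕ) (q : unitInterval) :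
    ∫ k, ((k : ℝ) - n * q) ∂(ProbabilityTheory.binomial n q) = 0 ∧
      ∫ k, ((k : ℝ) - n * q) ^ 2 ∂(ProbabilityTheory.binomial n q) = n * q * (1 - q) := by
  have hIic : Finset.Iic n = Finset.range (n + 1) := by ext; simp
  rw [integral_binomial, integral_binomial, hIic]
  have h0 := congrArg (Polynomial.eval (q : ℝ)) (bernsteinPolynomial.sum ℝ n)
  have h1 := congrArg (Polynomial.eval (q : ℝ)) (bernsteinPolynomial.sum_smul ℝ n)
  have h2 := congrArg (Polynomial.eval (q : ℝ)) (bernsteinPolynomial.variance ℝ n)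
  simp only [bernsteinPolynomial, Polynomial.eval_finsetSum, Polynomial.eval_mul,
    Polynomial.eval_pow, Polynomial.eval_sub, Polynomial.eval_one, Polynomial.eval_X,
    Polynomial.eval_natCast, nsmul_eq_mul, Polynomial.eval_mul] at h0 h1 h2
  constructor
  · simp only [smul_eq_mul, mul_sub]
    rw [Finset.sum_sub_distrib, ← Finset.sum_mul, h0, ← h1, one_mul, sub_eq_zero]
    exact Finset.sum_congr rfl fun k _ => by ring
  · rw [← h2]
    exact Finset.sum_congr rfl fun k _ => by rw [smul_eq_mul]; ring

/-- A binomial proportion lies in `[0, 1]`, so that its moments are bounded. -/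
lemma binomial_moments {Ω : Type*} [MeasurableSpace Ω] {P : Measure Ω}
    [IsProbabilityMeasure P] {Y : Ω → ℝ} {n : ℕ} {q : unitInterval} (hn : 0 < n)
    (hlaw : HasLaw Y ((ProbabilityTheory.binomial n q).map fun k : ℕ => (k : ℝ) / n) P) :
    MemLp Y 4 P ∧ ∫ ω, (Y ω - q) ∂P = 0 ∧ ∫ ω, (Y ω - q) ^ 2 ∂P = (q - (q : ℝ) ^ 2) / n ∧
      ∫ ω, (Y ω - q) ^ 4 ∂P ≤ 1 := by
  have hn' : (0 : ℝ) < n := Nat.cast_pos.2 hn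
  have hg : Measurable fun k : ℕ => (k : ℝ) / n := by fun_prop
  have hint : ∀ f : ℝ → ℝ, Measurable f →
      ∫ ω, f (Y ω) ∂P = ∫ k : ℕ, f (k / n) ∂(ProbabilityTheory.binomial n q) := by
    intro f hf
    have := hlaw.integral_comp (f := f) hf.aestronglyMeasurable
    simp only [Function.comp_def] at this
    rw [this, integral_map hg.aemeasurable hf.aestronglyMeasurable]
  have hrange : ∀ᵐ ω ∂P, Y ω ∈ Set.Icc (0 : ℝ) 1 := by
    rw [hlaw.ae_iff (p := fun y => y ∈ Set.Icc (0 : ℝ) 1)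
        (measurableSet_setOfPred.1 measurableSet_Icc),
      ae_map_iff hg.aemeasurable (p := fun y => y ∈ Set.Icc (0 : ℝ) 1) measurableSet_Icc]
    filter_upwards [ae_le_of_hasLaw_binomial (X := id) (n := n) (p := q) HasLaw.id] with k hk
    have hk' : (k : ℝ) ≤ n := by exact_mod_cast hk
    exact ⟨by positivity, div_le_one_of_le₀ hk' hn'.le⟩
  obtain ⟨e1, e2⟩ := integral_binomial_dev n q
  have hY : MemLp Y 4 P := by
    refine MemLp.of_bound hlaw.aemeasurable.aestronglyMeasurable 1 ?_
    filter_upwards [hrange] with ω hω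
    rw [Real.norm_of_nonneg hω.1]
    exact hω.2
  refine ⟨hY, ?_, ?_, ?_⟩
  · rw [hint (fun y => y - q) (by fun_prop)]
    have : ∀ k : ℕ, (k : ℝ) / n - q = 1 / n * (k - n * q) := fun k => by field_simp
    simp only [this]
    rw [integral_const_mul, e1, mul_zero]
  · rw [hint (fun y => (y - q) ^ 2) (by fun_prop)]
    have : ∀ k : ℕ, ((k : ℝ) / n - q) ^ 2 = 1 / n ^ 2 * (k - n * q) ^ 2 := fun k => by field_simp
    simp only [this]
    rw [integral_const_mul, e2]
    field_simp
  · have i4 : Integrable (fun ω => (Y ω - q) ^ 4) P := by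
      have hZ : MemLp (fun ω => Y ω - q) 4 P := hY.sub (memLp_const _)
      simpa only [← pow_mul] using (memLp_sq_of_four hZ).integrable_sq
    calc ∫ ω, (Y ω - q) ^ 4 ∂P ≤ ∫ _, (1 : ℝ) ∂P := by
          refine integral_mono_ae i4 (integrable_const _) ?_
          filter_upwards [hrange] with ω hω
          have h1 : |Y ω - q| ≤ 1 := by
            rw [abs_le]
            constructor <;> linarith [hω.1, hω.2, q.2.1, q.2.2]
          rw [← Even.pow_abs (by decide : Even 4)]
          exact pow_le_one₀ (abs_nonneg _) h1
      _ = 1 := by simp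

/-! ### Decay of the Gamma function on vertical lines -/

/-- The ratio `|Γ(σ + it)| / Γ(σ)` increases with `σ`: it is the limit of the products
`∏ j, (σ + j) / |σ + j + it|`, whose factors do. -/
lemma norm_Gamma_mul_le {σ σ' : ℝ} (hσ : 0 < σ) (h : σ ≤ σ') (t : ℝ) :
    ‖Complex.Gamma (σ + t * Complex.I)‖ * Real.Gamma σ' ≤
      ‖Complex.Gamma (σ' + t * Complex.I)‖ * Real.Gamma σ := by
  have hre : ∀ {s : ℝ}, 0 < s → ‖Complex.Gamma (s : ℂ)‖ = Real.Gamma s := fun hs => by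
    rw [Complex.Gamma_ofReal, Complex.norm_real, Real.norm_of_nonneg (Real.Gamma_pos_of_pos hs).le]
  have hσ' : 0 < σ' := hσ.trans_le h
  rw [← hre hσ, ← hre hσ']
  have hlim := fun s : ℂ => (Complex.GammaSeq_tendsto_Gamma s).norm
  refine le_of_tendsto_of_tendsto ((hlim _).mul (hlim _)) ((hlim _).mul (hlim _)) ?_
  filter_upwards [eventually_gt_atTop 0] with n hn
  have hnorm : ∀ s u : ℝ, ‖Complex.GammaSeq (s + u * Complex.I) n‖ =
      (n : ℝ) ^ s * n.factorial / ∏ j ∈ Finset.range (n + 1), ‖(s : ℂ) + u * Complex.I + j‖ := by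
    intro s u
    rw [Complex.GammaSeq, norm_div, norm_mul, norm_prod, Complex.norm_natCast,
      Complex.norm_natCast_cpow_of_pos hn]
    simp
  have hnorm0 : ∀ {s : ℝ}, 0 < s → ‖Complex.GammaSeq (s : ℂ) n‖ =
      (n : ℝ) ^ s * n.factorial / ∏ j ∈ Finset.range (n + 1), (s + j) := by
    intro s hs
    have := hnorm s 0
    simp only [Complex.ofReal_zero, zero_mul, add_zero] at this
    rw [this]
    congr 1
    refine Finset.prod_congr rfl fun j _ => ?_
    rw [← Complex.ofReal_natCast, ← Complex.ofReal_add, Complex.norm_real,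
      Real.norm_of_nonneg (by positivity)]
  have hne : ∀ {s : ℝ}, 0 < s → ∀ j : ℕ, 0 < ‖(s : ℂ) + t * Complex.I + j‖ := by
    intro s hs j
    refine norm_pos_iff.2 fun h0 => ?_
    have := congrArg Complex.re h0
    simp at this
    have : (0 : ℝ) ≤ j := Nat.cast_nonneg j
    linarith
  have hprod : (∏ j ∈ Finset.range (n + 1), ‖(σ' : ℂ) + t * Complex.I + j‖) *
        ∏ j ∈ Finset.range (n + 1), (σ + j) ≤
      (∏ j ∈ Finset.range (n + 1), ‖(σ : ℂ) + t * Complex.I + j‖) *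
        ∏ j ∈ Finset.range (n + 1), (σ' + j) := by
    rw [← Finset.prod_mul_distrib, ← Finset.prod_mul_distrib]
    refine Finset.prod_le_prod (fun j _ => by positivity) fun j _ => ?_
    have hsq : ∀ s : ℝ, ‖(s : ℂ) + t * Complex.I + j‖ ^ 2 = (s + j) ^ 2 + t ^ 2 := fun s => by
      rw [Complex.sq_norm, Complex.normSq_apply]
      simp
      ring
    refine (pow_le_pow_iff_left₀ (by positivity) (by positivity) two_ne_zero).1 ?_
    rw [mul_pow, mul_pow, hsq, hsq]
    have h1 : (σ + j) ^ 2 ≤ (σ' + j) ^ 2 := by gcongr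
    nlinarith [mul_le_mul_of_nonneg_right h1 (sq_nonneg t)]
  rw [hnorm, hnorm, hnorm0 hσ, hnorm0 hσ', div_mul_div_comm, div_mul_div_comm]
  have p1 : 0 < ∏ j ∈ Finset.range (n + 1), ‖(σ : ℂ) + t * Complex.I + j‖ :=
    Finset.prod_pos fun j _ => hne hσ j
  have p2 : 0 < ∏ j ∈ Finset.range (n + 1), ‖(σ' : ℂ) + t * Complex.I + j‖ :=
    Finset.prod_pos fun j _ => hne hσ' j
  have p3 : 0 < ∏ j ∈ Finset.range (n + 1), (σ + j) :=
    Finset.prod_pos fun j _ => by positivity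
  have p4 : 0 < ∏ j ∈ Finset.range (n + 1), (σ' + j) :=
    Finset.prod_pos fun j _ => by positivity
  rw [mul_comm ((n : ℝ) ^ σ' * _)]
  exact div_le_div_of_nonneg_left (by positivity) (by positivity) hprod

/-- By the reflection formula `|Γ(1/2 + it)|² = π / cosh (π t)`. -/
lemma norm_Gamma_half_le (t : ℝ) : ‖Complex.Gamma ((1 / 2 : ℝ) + t * Complex.I)‖ ≤
    √(2 * Real.pi) * Real.exp (-(Real.pi / 2 * |t|)) := by
  set z : ℂ := (1 / 2 : ℝ) + t * Complex.I with hz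
  have hconj : 1 - z = (starRingEnd ℂ) z := by
    apply Complex.ext <;> simp [hz]
    norm_num
  have hsin : Complex.sin (Real.pi * z) = (Real.cosh (Real.pi * t) : ℝ) := by
    have : (Real.pi : ℂ) * z = (Real.pi * t : ℝ) * Complex.I + Real.pi / 2 := by
      rw [hz]; push_cast; ring
    rw [this, Complex.sin_add_pi_div_two, Complex.cos_mul_I, Complex.ofReal_cosh]
  have h1 := Complex.Gamma_mul_Gamma_one_sub z
  rw [hconj, Complex.Gamma_conj, Complex.mul_conj, hsin, ← Complex.ofReal_div,
    Complex.ofReal_inj, ← Complex.sq_norm] at h1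
  refine (pow_le_pow_iff_left₀ (by positivity) (by positivity) two_ne_zero).1 ?_
  rw [h1, mul_pow, Real.sq_sqrt (by positivity), ← Real.exp_nat_mul,
    div_le_iff₀ (Real.cosh_pos _)]
  have h2 : Real.exp (Real.pi * |t|) ≤ 2 * Real.cosh (Real.pi * t) := by
    rw [← Real.cosh_abs, abs_mul, abs_of_pos Real.pi_pos, Real.cosh_eq]
    linarith [Real.exp_pos (-(Real.pi * |t|))]
  have h3 : Real.exp ((2 : ℕ) * -(Real.pi / 2 * |t|)) * Real.exp (Real.pi * |t|) = 1 := by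
    rw [← Real.exp_add, ← Real.exp_zero]
    congr 1
    push_cast
    ring
  have h4 := Real.exp_pos ((2 : ℕ) * -(Real.pi / 2 * |t|))
  nlinarith [mul_le_mul_of_nonneg_left h2 h4.le, Real.pi_pos]

lemma exists_norm_Gamma_half_add_nat_le (n : ℕ) : ∃ C : ℝ, 0 ≤ C ∧ ∀ t : ℝ,
    ‖Complex.Gamma (((n : ℝ) + 1 / 2 : ℝ) + t * Complex.I)‖ ≤
      C * (1 + |t|) ^ n * Real.exp (-(Real.pi / 2 * |t|)) := by
  induction n with
  | zero =>
    refine ⟨√(2 * Real.pi), by positivity, fun t => ?_⟩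
    simpa using norm_Gamma_half_le t
  | succ n ih =>
    obtain ⟨C, hC, h⟩ := ih
    refine ⟨(n + 1) * C, by positivity, fun t => ?_⟩
    set z : ℂ := ((n : ℝ) + 1 / 2 : ℝ) + t * Complex.I with hz
    have hz0 : z ≠ 0 := fun h0 => by
      have := congrArg Complex.re h0
      simp [hz] at this
      have : (0 : ℝ) ≤ n := Nat.cast_nonneg n
      linarith
    have h1 : (((n + 1 : ℕ) : ℝ) + 1 / 2 : ℝ) + t * Complex.I = z + 1 := by
      rw [hz]; push_cast; ring
    have h2 : ‖z‖ ≤ (n + 1) * (1 + |t|) := by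
      refine (norm_add_le _ _).trans ?_
      rw [Complex.norm_real, Real.norm_of_nonneg (by positivity), norm_mul, Complex.norm_I,
        Complex.norm_real, Real.norm_eq_abs, mul_one]
      nlinarith [abs_nonneg t, (Nat.cast_nonneg n : (0 : ℝ) ≤ n)]
    rw [h1, Complex.Gamma_add_one z hz0, norm_mul]
    calc ‖z‖ * ‖Complex.Gamma z‖
        ≤ (n + 1) * (1 + |t|) * (C * (1 + |t|) ^ n * Real.exp (-(Real.pi / 2 * |t|))) :=
          mul_le_mul h2 (h t) (norm_nonneg _) (by positivity)
      _ = _ := by ring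

/-- Exponential decay of `Γ` on a vertical strip. -/
lemma exists_norm_Gamma_le {a : ℝ} (ha : 0 < a) (b : ℝ) : ∃ (C : ℝ) (n : ℕ), 0 ≤ C ∧
    ∀ σ ∈ Set.Icc a b, ∀ t : ℝ, ‖Complex.Gamma (σ + t * Complex.I)‖ ≤
      C * (1 + |t|) ^ n * Real.exp (-(Real.pi / 2 * |t|)) := by
  obtain ⟨n, hn⟩ := exists_nat_ge b
  obtain ⟨C, hC, h⟩ := exists_norm_Gamma_half_add_nat_le n
  have hcont : ContinuousOn Real.Gamma (Set.Icc a b) := fun σ hσ =>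
    (Real.differentiableAt_Gamma fun m => by
      have : (0 : ℝ) ≤ m := Nat.cast_nonneg m
      have := hσ.1
      linarith).continuousAt.continuousWithinAt
  obtain ⟨M, hM⟩ := isCompact_Icc.exists_bound_of_continuousOn hcont
  have hG : 0 < Real.Gamma ((n : ℝ) + 1 / 2) := Real.Gamma_pos_of_pos (by positivity)
  refine ⟨C * |M| / Real.Gamma ((n : ℝ) + 1 / 2), n, by positivity, fun σ hσ t => ?_⟩
  have h1 := norm_Gamma_mul_le (ha.trans_le hσ.1)
    (show σ ≤ (n : ℝ) + 1 / 2 by linarith [hσ.2]) t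
  have h2 : Real.Gamma σ ≤ |M| :=
    (le_abs_self _).trans ((hM σ hσ).trans (le_abs_self M))
  have h3 := h t
  have h4 : ‖Complex.Gamma (((n : ℝ) + 1 / 2 : ℝ) + t * Complex.I)‖ * Real.Gamma σ ≤
      C * (1 + |t|) ^ n * Real.exp (-(Real.pi / 2 * |t|)) * |M| :=
    mul_le_mul h3 h2 (Real.Gamma_pos_of_pos (ha.trans_le hσ.1)).le (by positivity)
  calc _ ≤ C * (1 + |t|) ^ n * Real.exp (-(Real.pi / 2 * |t|)) * |M| /
        Real.Gamma ((n : ℝ) + 1 / 2) := (le_div_iff₀ hG).2 (h1.trans h4)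
    _ = _ := by ring

/-! ### A contour shift -/

lemma exists_one_add_pow_mul_exp_le {δ : ℝ} (hδ : 0 < δ) (K : ℕ) : ∃ C : ℝ, 0 ≤ C ∧
    ∀ u : ℝ, 0 ≤ u → (1 + u) ^ K * Real.exp (-(δ * u)) ≤ C * Real.exp (-(δ / 2 * u)) := by
  refine ⟨(2 / δ) ^ K * K.factorial * Real.exp (δ / 2), by positivity, fun u hu => ?_⟩
  have h1 := Real.pow_div_factorial_le_exp (δ / 2 * (1 + u)) (by positivity) K
  rw [div_le_iff₀ (by positivity), mul_pow] at h1
  have h2 : (1 + u) ^ K ≤ (2 / δ) ^ K * K.factorial * Real.exp (δ / 2 * (1 + u)) := by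
    calc (1 + u) ^ K = (2 / δ) ^ K * ((δ / 2) ^ K * (1 + u) ^ K) := by
          rw [← mul_assoc, ← mul_pow, div_mul_div_comm, mul_comm δ 2, div_self (by positivity),
            one_pow, one_mul]
      _ ≤ (2 / δ) ^ K * (Real.exp (δ / 2 * (1 + u)) * K.factorial) := by gcongr
      _ = _ := by ring
  calc _ ≤ (2 / δ) ^ K * K.factorial * Real.exp (δ / 2 * (1 + u)) * Real.exp (-(δ * u)) := by
        gcongr
    _ = (2 / δ) ^ K * K.factorial * (Real.exp (δ / 2 * (1 + u)) * Real.exp (-(δ * u))) := by ring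
    _ = (2 / δ) ^ K * K.factorial * (Real.exp (δ / 2) * Real.exp (-(δ / 2 * u))) := by
        rw [← Real.exp_add, ← Real.exp_add]
        ring_nf
    _ = _ := by ring

lemma integrable_exp_neg_mul_abs {ε : ℝ} (hε : 0 < ε) :
    Integrable fun x : ℝ => Real.exp (-(ε * |x|)) := by
  have h : IntegrableOn (fun x : ℝ => Real.exp (-(ε * |x|))) (Set.Ioi 0) := by
    refine (integrableOn_exp_mul_Ioi (neg_lt_zero.2 hε) 0).congr_fun (fun x hx => ?_)
      measurableSet_Ioi
    simp only [abs_of_pos (Set.mem_Ioi.1 hx), neg_mul]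
  have h' : IntegrableOn (fun x : ℝ => Real.exp (-(ε * |x|))) (Set.Iic 0) := by
    refine (integrableOn_exp_mul_Iic hε 0).congr_fun (fun x hx => ?_) measurableSet_Iic
    simp only [abs_of_nonpos (Set.mem_Iic.1 hx), mul_neg, neg_neg]
  rw [← integrableOn_univ, ← Set.Iic_union_Ioi (a := (0 : ℝ))]
  exact h'.union h

/-- For a function holomorphic and exponentially decaying on the strip `|Im z| ≤ 1` the integrals
along the two boundary lines agree. -/
lemma integral_add_I_eq_integral_sub_I {H : ℂ → ℂ} {C ε : ℝ} (hε : 0 < ε)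
    (hd : ∀ z : ℂ, |z.im| ≤ 1 → DifferentiableAt ℂ H z)
    (hb : ∀ z : ℂ, |z.im| ≤ 1 → ‖H z‖ ≤ C * Real.exp (-(ε * |z.re|))) :
    ∫ x : ℝ, H (x + Complex.I) = ∫ x : ℝ, H (x - Complex.I) := by
  have hcont : ∀ y : ℝ, |y| ≤ 1 → Continuous fun x : ℝ => H (x + y * Complex.I) := by
    intro y hy
    refine continuous_iff_continuousAt.2 fun x => ?_
    exact ContinuousAt.comp (f := fun x : ℝ => (x : ℂ) + y * Complex.I)
      (hd _ (by simpa using hy)).continuousAt (by fun_prop)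
  have hint : ∀ y : ℝ, |y| ≤ 1 → Integrable fun x : ℝ => H (x + y * Complex.I) := by
    intro y hy
    refine ((integrable_exp_neg_mul_abs hε).const_mul C).mono'
      (hcont y hy).aestronglyMeasurable (ae_of_all _ fun x => ?_)
    simpa using hb (x + y * Complex.I) (by simpa using hy)
  have hhor : ∀ y : ℝ, |y| ≤ 1 →
      Tendsto (fun T : ℝ => ∫ x in (-T)..T, H (x + y * Complex.I)) atTop
        (𝓝 (∫ x : ℝ, H (x + y * Complex.I))) := fun y hy =>
    intervalIntegral_tendsto_integral (hint y hy) tendsto_neg_atTop_atBot tendsto_id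
  have hver : ∀ s : ℝ, |s| = 1 → Tendsto (fun T : ℝ =>
      ∫ y in (-1 : ℝ)..1, H ((s * T : ℝ) + y * Complex.I)) atTop (𝓝 0) := by
    intro s hs
    have h0 : Tendsto (fun T : ℝ => C * Real.exp (-(ε * T)) * |(1 : ℝ) - -1|) atTop (𝓝 0) := by
      have h1 : Tendsto (fun T : ℝ => Real.exp (-(ε * T))) atTop (𝓝 0) :=
        Real.tendsto_exp_neg_atTop_nhds_zero.comp (tendsto_id.const_mul_atTop hε)
      simpa using (h1.const_mul C).mul_const |(1 : ℝ) - -1|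
    refine squeeze_zero_norm' ?_ h0
    filter_upwards [eventually_ge_atTop 0] with T hT
    refine intervalIntegral.norm_integral_le_of_norm_le_const fun y hy => ?_
    rw [Set.uIoc_of_le (by norm_num)] at hy
    have h2 := hb ((s * T : ℝ) + y * Complex.I) (by
      simpa [abs_le] using ⟨hy.1.le, hy.2⟩)
    simpa [abs_mul, hs, abs_of_nonneg hT] using h2
  have hrect : ∀ T : ℝ, (∫ x in (-T)..T, H (x + (-1 : ℝ) * Complex.I)) -
      (∫ x in (-T)..T, H (x + (1 : ℝ) * Complex.I)) +
      Complex.I • (∫ y in (-1 : ℝ)..1, H ((1 * T : ℝ) + y * Complex.I)) -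
      Complex.I • (∫ y in (-1 : ℝ)..1, H ((-1 * T : ℝ) + y * Complex.I)) = 0 := by
    intro T
    have := Complex.integral_boundary_rect_eq_zero_of_differentiableOn H
      ⟨-T, -1⟩ ⟨T, 1⟩ (fun z hz => (hd z ?_).differentiableWithinAt)
    · simpa using this
    · have h2 := hz.2
      simp only [Set.mem_preimage] at h2
      rw [Set.uIcc_of_le (by norm_num)] at h2
      exact abs_le.2 h2
  have hlim := (((hhor (-1) (by simp)).sub (hhor 1 (by simp))).add
    ((hver 1 (by simp)).const_smul Complex.I)).sub ((hver (-1) (by simp)).const_smul Complex.I)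
  simp only [hrect] at hlim
  have h := tendsto_nhds_unique hlim tendsto_const_nhds
  simp only [smul_zero, add_zero, sub_zero, sub_eq_zero] at h
  simpa [sub_eq_add_neg] using h.symm

/-! ### The generalized hyperbolic secant distribution -/

lemma norm_exp_ofReal_mul (φ : ℝ) (z : ℂ) : ‖Complex.exp (φ * z)‖ = Real.exp (φ * z.re) := by
  rw [Complex.norm_exp]; simp

/-- The unnormalized density of the generalized hyperbolic secant distribution. -/
noncomputable def ghsKernel (r φ x : ℝ) : ℝ :=
  ‖Complex.Gamma (((r : ℂ) + (x : ℂ) * Complex.I) / 2)‖ ^ 2 * Real.exp (φ * x)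

/-- The holomorphic function whose values on the lines `Im z = ± 1` are the integrands
`(x ± i) ^ k (r ∓ i x) / 2 * exp (± i φ)` against the kernel `ghsKernel`. -/
noncomputable def ghsContour (r φ : ℝ) (k : ℕ) (z : ℂ) : ℂ :=
  z ^ k * Complex.Gamma ((r + 1 + Complex.I * z) / 2) *
    Complex.Gamma ((r + 1 - Complex.I * z) / 2) * Complex.exp (φ * z)

lemma differentiableAt_ghsContour {r : ℝ} (hr : 0 < r) (φ : ℝ) (k : ℕ) {z : ℂ} (hz : |z.im| ≤ 1) :
    DifferentiableAt ℂ (ghsContour r φ k) z := by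
  obtain ⟨h1, h2⟩ := abs_le.1 hz
  have hΓ : ∀ {w : ℂ}, 0 < w.re → DifferentiableAt ℂ Complex.Gamma w := fun {w} hw =>
    Complex.differentiableAt_Gamma w fun m h0 => by
      have := congrArg Complex.re h0
      simp at this
      have : (0 : ℝ) ≤ m := Nat.cast_nonneg m
      linarith
  have g1 : DifferentiableAt ℂ (fun z : ℂ => Complex.Gamma ((r + 1 + Complex.I * z) / 2)) z :=
    DifferentiableAt.comp (f := fun z : ℂ => (r + 1 + Complex.I * z) / 2) z
      (hΓ (by simp; linarith)) (by fun_prop)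
  have g2 : DifferentiableAt ℂ (fun z : ℂ => Complex.Gamma ((r + 1 - Complex.I * z) / 2)) z :=
    DifferentiableAt.comp (f := fun z : ℂ => (r + 1 - Complex.I * z) / 2) z
      (hΓ (by simp; linarith)) (by fun_prop)
  unfold ghsContour
  fun_prop

lemma exists_norm_ghsContour_le {r φ : ℝ} (hr : 0 < r) (hφ : |φ| < Real.pi / 2) (k : ℕ) :
    ∃ C ε : ℝ, 0 < ε ∧ ∀ z : ℂ, |z.im| ≤ 1 →
      ‖ghsContour r φ k z‖ ≤ C * Real.exp (-(ε * |z.re|)) := by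
  obtain ⟨C, n, hC, h⟩ := exists_norm_Gamma_le (show 0 < r / 2 by positivity) (r / 2 + 1)
  obtain ⟨D, hD, hpow⟩ := exists_one_add_pow_mul_exp_le (sub_pos.2 hφ) (k + 2 * n)
  refine ⟨C ^ 2 * D, (Real.pi / 2 - |φ|) / 2, by linarith, fun z hz => ?_⟩
  obtain ⟨h1, h2⟩ := abs_le.1 hz
  set u := |z.re| with hu
  have hu0 : 0 ≤ u := abs_nonneg _
  have e1 : (r + 1 + Complex.I * z) / 2 =
      ((r + 1 - z.im) / 2 : ℝ) + (z.re / 2 : ℝ) * Complex.I := by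
    apply Complex.ext <;> simp
    ring
  have e2 : (r + 1 - Complex.I * z) / 2 =
      ((r + 1 + z.im) / 2 : ℝ) + (-z.re / 2 : ℝ) * Complex.I := by
    apply Complex.ext <;> simp
  have hG : ∀ σ ∈ Set.Icc (r / 2) (r / 2 + 1), ∀ t : ℝ, |t| = u / 2 →
      ‖Complex.Gamma (σ + t * Complex.I)‖ ≤ C * (1 + u) ^ n * Real.exp (-(Real.pi / 4 * u)) := by
    intro σ hσ t ht
    refine (h σ hσ t).trans ?_
    rw [ht]
    have : Real.pi / 2 * (u / 2) = Real.pi / 4 * u := by ring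
    rw [this]
    gcongr
    linarith
  have g1 := hG ((r + 1 - z.im) / 2) ⟨by linarith, by linarith⟩ (z.re / 2)
    (by rw [abs_div, abs_two])
  have g2 := hG ((r + 1 + z.im) / 2) ⟨by linarith, by linarith⟩ (-z.re / 2)
    (by rw [abs_div, abs_neg, abs_two])
  have g3 : ‖z ^ k‖ ≤ (1 + u) ^ k := by
    rw [norm_pow]
    refine pow_le_pow_left₀ (norm_nonneg _) ?_ k
    linarith [Complex.norm_le_abs_re_add_abs_im z]
  have g4 : ‖Complex.exp (φ * z)‖ ≤ Real.exp (|φ| * u) := by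
    rw [norm_exp_ofReal_mul]
    refine Real.exp_le_exp.2 ((le_abs_self _).trans_eq ?_)
    rw [abs_mul]
  unfold ghsContour
  rw [norm_mul, norm_mul, norm_mul, e1, e2]
  calc _ ≤ (1 + u) ^ k * (C * (1 + u) ^ n * Real.exp (-(Real.pi / 4 * u))) *
        (C * (1 + u) ^ n * Real.exp (-(Real.pi / 4 * u))) * Real.exp (|φ| * u) := by gcongr
    _ = C ^ 2 * ((1 + u) ^ (k + 2 * n) * (Real.exp (-(Real.pi / 4 * u)) *
        Real.exp (-(Real.pi / 4 * u)) * Real.exp (|φ| * u))) := by ring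
    _ = C ^ 2 * ((1 + u) ^ (k + 2 * n) * Real.exp (-((Real.pi / 2 - |φ|) * u))) := by
        rw [← Real.exp_add, ← Real.exp_add]
        ring_nf
    _ ≤ C ^ 2 * (D * Real.exp (-((Real.pi / 2 - |φ|) / 2 * u))) :=
        mul_le_mul_of_nonneg_left (hpow u hu0) (by positivity)
    _ = _ := by ring

lemma Gamma_ghs_ne_zero {r : ℝ} (hr : 0 < r) (x : ℝ) : ((r : ℂ) + x * Complex.I) / 2 ≠ 0 :=
  fun h => by
    have := congrArg Complex.re h
    simp at this
    linarith

lemma ghsContour_add_I {r : ℝ} (hr : 0 < r) (φ : ℝ) (k : ℕ) (x : ℝ) :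
    ghsContour r φ k (x + Complex.I) = (ghsKernel r φ x : ℂ) * ((x + Complex.I) ^ k *
      ((r - x * Complex.I) / 2) * Complex.exp (φ * Complex.I)) := by
  have e1 : ((r : ℂ) + 1 + Complex.I * (x + Complex.I)) / 2 = (r + x * Complex.I) / 2 := by
    linear_combination (1 / 2 : ℂ) * Complex.I_mul_I
  have e2 : ((r : ℂ) + 1 - Complex.I * (x + Complex.I)) / 2 =
      (starRingEnd ℂ) ((r + x * Complex.I) / 2) + 1 := by
    simp only [map_div₀, map_add, map_mul, Complex.conj_ofReal, Complex.conj_I, Complex.conj_ofNat]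
    linear_combination (-1 / 2 : ℂ) * Complex.I_mul_I
  have e3 : (starRingEnd ℂ) (((r : ℂ) + x * Complex.I) / 2) = (r - x * Complex.I) / 2 := by
    simp only [map_div₀, map_add, map_mul, Complex.conj_ofReal, Complex.conj_I, Complex.conj_ofNat]
    ring
  have hne : (starRingEnd ℂ) (((r : ℂ) + x * Complex.I) / 2) ≠ 0 :=
    (map_ne_zero _).2 (Gamma_ghs_ne_zero hr x)
  have e4 : Complex.exp (φ * (x + Complex.I)) =
      (Real.exp (φ * x) : ℂ) * Complex.exp (φ * Complex.I) := by
    rw [Complex.ofReal_exp, ← Complex.exp_add]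
    push_cast
    ring_nf
  unfold ghsContour ghsKernel
  rw [e1, e2, Complex.Gamma_add_one _ hne, Complex.Gamma_conj, e4, e3]
  have e5 := Complex.mul_conj (Complex.Gamma (((r : ℂ) + x * Complex.I) / 2))
  rw [← Complex.sq_norm] at e5
  push_cast at e5 ⊢
  linear_combination ((x + Complex.I) ^ k * ((r - x * Complex.I) / 2) * Complex.exp (φ * x) *
    Complex.exp (φ * Complex.I)) * e5

lemma ghsContour_conj (r φ : ℝ) (k : ℕ) (z : ℂ) :
    ghsContour r φ k ((starRingEnd ℂ) z) = (starRingEnd ℂ) (ghsContour r φ k z) := by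
  unfold ghsContour
  simp only [map_mul, map_pow, ← Complex.Gamma_conj, ← Complex.exp_conj, map_div₀, map_add,
    map_sub, map_one, Complex.conj_ofReal, Complex.conj_I, Complex.conj_ofNat]
  ring_nf

/-- The values on `Im z = -1` are the conjugates of those on `Im z = 1`, so that the contour shift
makes the imaginary part of the integral vanish. -/
lemma integral_ghsKernel_mul_im {r : ℝ} (hr : 0 < r) (l : ℝ) (k : ℕ) :
    ∫ x : ℝ, ghsKernel r (Real.arctan l) x *
      (((x + Complex.I) ^ k * ((r - x * Complex.I) * (1 + l * Complex.I))).im) = 0 := by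
  set φ := Real.arctan l with hφ
  have hφ2 : |φ| < Real.pi / 2 :=
    abs_lt.2 ⟨Real.neg_pi_div_two_lt_arctan l, Real.arctan_lt_pi_div_two l⟩
  obtain ⟨C, ε, hε, hb⟩ := exists_norm_ghsContour_le hr hφ2 k
  have hshift := integral_add_I_eq_integral_sub_I hε
    (fun z hz => differentiableAt_ghsContour hr φ k hz) hb
  have hconj : ∀ x : ℝ, ghsContour r φ k (x - Complex.I) =
      (starRingEnd ℂ) (ghsContour r φ k (x + Complex.I)) := fun x => by
    rw [← ghsContour_conj]
    simp [sub_eq_add_neg]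
  have hint : Integrable fun x : ℝ => ghsContour r φ k (x + Complex.I) := by
    have hc : Continuous fun x : ℝ => ghsContour r φ k (x + Complex.I) := by
      refine continuous_iff_continuousAt.2 fun x => ?_
      exact ContinuousAt.comp (f := fun x : ℝ => (x : ℂ) + Complex.I)
        (differentiableAt_ghsContour hr φ k (by simp)).continuousAt (by fun_prop)
    refine ((integrable_exp_neg_mul_abs hε).const_mul C).mono' hc.aestronglyMeasurable
      (ae_of_all _ fun x => ?_)
    simpa using hb (x + Complex.I) (by simp)
  have him : ∫ x : ℝ, (ghsContour r φ k (x + Complex.I)).im = 0 := by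
    have h1 : ∫ x : ℝ, (ghsContour r φ k (x + Complex.I)).im =
        (∫ x : ℝ, ghsContour r φ k (x + Complex.I)).im := integral_im hint
    rw [h1]
    have h2 : (∫ x : ℝ, ghsContour r φ k (x + Complex.I)) =
        (starRingEnd ℂ) (∫ x : ℝ, ghsContour r φ k (x + Complex.I)) := by
      rw [← integral_conj]
      simp only [← hconj]
      exact hshift
    exact Complex.conj_eq_iff_im.1 h2.symm
  have hcos : 0 < Real.cos φ := Real.cos_arctan_pos l
  have hexp : Complex.exp (φ * Complex.I) = (Real.cos φ : ℂ) * (1 + l * Complex.I) := by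
    have hl : l * Real.cos φ = Real.sin φ := by
      conv_lhs => rw [← Real.tan_arctan l, ← hφ]
      exact Real.tan_mul_cos hcos.ne'
    rw [Complex.exp_mul_I, ← Complex.ofReal_cos, ← Complex.ofReal_sin, ← hl]
    push_cast
    ring
  have hpoint : ∀ x : ℝ, (ghsContour r φ k (x + Complex.I)).im = Real.cos φ / 2 *
      (ghsKernel r φ x *
        (((x + Complex.I) ^ k * ((r - x * Complex.I) * (1 + l * Complex.I))).im)) := by
    intro x
    have : ghsContour r φ k (x + Complex.I) = ((Real.cos φ / 2 * ghsKernel r φ x : ℝ) : ℂ) *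
        ((x + Complex.I) ^ k * ((r - x * Complex.I) * (1 + l * Complex.I))) := by
      rw [ghsContour_add_I hr, hexp]
      push_cast
      ring
    rw [this, Complex.im_ofReal_mul]
    ring
  simp only [hpoint] at him
  rw [integral_const_mul] at him
  exact (mul_eq_zero.1 him).resolve_left (by positivity)

lemma continuous_ghsKernel {r : ℝ} (hr : 0 < r) (φ : ℝ) : Continuous (ghsKernel r φ) := by
  have h : Continuous fun x : ℝ => Complex.Gamma (((r : ℂ) + (x : ℂ) * Complex.I) / 2) := by
    refine continuous_iff_continuousAt.2 fun x => ?_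
    refine ContinuousAt.comp (f := fun x : ℝ => ((r : ℂ) + (x : ℂ) * Complex.I) / 2)
      (Complex.differentiableAt_Gamma _ fun m h0 => ?_).continuousAt (by fun_prop)
    have := congrArg Complex.re h0
    simp at this
    have : (0 : ℝ) ≤ m := Nat.cast_nonneg m
    linarith
  unfold ghsKernel
  fun_prop

lemma integrable_ghsKernel_mul_pow {r φ : ℝ} (hr : 0 < r) (hφ : |φ| < Real.pi / 2) (k : ℕ) :
    Integrable fun x : ℝ => ghsKernel r φ x * x ^ k := by
  obtain ⟨C, ε, hε, hb⟩ := exists_norm_ghsContour_le hr hφ k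
  refine ((integrable_exp_neg_mul_abs hε).const_mul (C * (2 / r))).mono'
    ((continuous_ghsKernel hr φ).mul (continuous_pow k)).aestronglyMeasurable
    (ae_of_all _ fun x => ?_)
  have h1 := hb (x + Complex.I) (by simp)
  have hK : 0 ≤ ghsKernel r φ x := by unfold ghsKernel; positivity
  rw [ghsContour_add_I hr, norm_mul, norm_mul, norm_mul, Complex.norm_real,
    Real.norm_of_nonneg hK, Complex.norm_exp_ofReal_mul_I, mul_one, norm_pow] at h1
  have h2 : |x| ≤ ‖(x : ℂ) + Complex.I‖ := by
    simpa using Complex.abs_re_le_norm ((x : ℂ) + Complex.I)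
  have h3 : r / 2 ≤ ‖((r : ℂ) - x * Complex.I) / 2‖ := by
    have := Complex.abs_re_le_norm (((r : ℂ) - x * Complex.I) / 2)
    simp only [Complex.div_ofNat_re, Complex.sub_re, Complex.ofReal_re, Complex.re_ofReal_mul,
      Complex.I_re, mul_zero, sub_zero] at this
    exact (le_abs_self _).trans this
  simp only [Complex.add_re, Complex.ofReal_re, Complex.I_re, add_zero] at h1
  rw [norm_mul, Real.norm_of_nonneg hK, norm_pow, Real.norm_eq_abs]
  have h4 : ghsKernel r φ x * (|x| ^ k * (r / 2)) ≤ C * Real.exp (-(ε * |x|)) :=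
    (mul_le_mul_of_nonneg_left (mul_le_mul (pow_le_pow_left₀ (abs_nonneg _) h2 k) h3
      (by positivity) (by positivity)) hK).trans h1
  calc ghsKernel r φ x * |x| ^ k = ghsKernel r φ x * (|x| ^ k * (r / 2)) * (2 / r) := by
        field_simp
    _ ≤ C * Real.exp (-(ε * |x|)) * (2 / r) := by gcongr
    _ = _ := by ring

lemma hasQVFMoments_ghs {Ω : Type*} [MeasurableSpace Ω] {P : Measure Ω}
    [IsProbabilityMeasure P] {Y : Ω → ℝ} {α τ l : ℝ} (hα : 0 < α) (hτ : 0 < τ)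
    (hlaw : HasLaw Y ((ghsMeasure (τ * α) l).map fun x : ℝ => x / τ) P) :
    HasQVFMoments P Y α 0 (1 / α) τ (α * l) := by
  have hr : 0 < τ * α := by positivity
  generalize hrdef : τ * α = r at hr hlaw
  have hφ : |Real.arctan l| < Real.pi / 2 :=
    abs_lt.2 ⟨Real.neg_pi_div_two_lt_arctan l, Real.arctan_lt_pi_div_two l⟩
  have hprob : IsProbabilityMeasure (ghsMeasure r l) := by
    rw [← Measure.isProbabilityMeasure_map_iff (f := fun x : ℝ => x / τ) (by fun_prop),
      ← hlaw.isProbabilityMeasure_iff]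
    infer_instance
  set c : ℝ := (2 : ℝ) ^ (r - 2) / (Real.pi * Real.Gamma r) * (1 + l ^ 2) ^ (-r / 2) with hc
  have hpdf : ∀ x, ghsPDFReal r l x = c * ghsKernel r (Real.arctan l) x := fun x => by
    rw [hc, ghsPDFReal, ghsKernel]; ring
  have hc0 : 0 ≤ c := by
    have := Real.Gamma_pos_of_pos hr
    positivity
  have hpdf0 : ∀ x, 0 ≤ ghsPDFReal r l x := fun x => by
    rw [hpdf]; unfold ghsKernel; positivity
  have hcont : Continuous (ghsPDFReal r l) := by
    rw [funext hpdf]; exact (continuous_ghsKernel hr _).const_mul c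
  have hmeas : Measurable fun x => ENNReal.ofReal (ghsPDFReal r l x) :=
    hcont.measurable.ennreal_ofReal
  have hI : ∀ f : ℝ → ℝ, ∫ x, f x ∂(ghsMeasure r l) =
      c * ∫ x, ghsKernel r (Real.arctan l) x * f x := fun f => by
    rw [ghsMeasure, integral_withDensity_eq_integral_toReal_smul hmeas
      (ae_of_all _ fun x => ENNReal.ofReal_lt_top), ← integral_const_mul]
    simp only [ENNReal.toReal_ofReal (hpdf0 _)]
    simp only [smul_eq_mul, hpdf, mul_assoc]
  have h4 : Integrable (fun x : ℝ => x ^ 4) (ghsMeasure r l) := by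
    rw [ghsMeasure, integrable_withDensity_iff_integrable_smul₀' hmeas.aemeasurable
      (ae_of_all _ fun x => ENNReal.ofReal_lt_top)]
    simp only [ENNReal.toReal_ofReal (hpdf0 _)]
    simp only [smul_eq_mul, hpdf, mul_assoc]
    exact (integrable_ghsKernel_mul_pow hr hφ 4).const_mul c
  have hQ : ∀ k : ℕ, ∫ x : ℝ, (((x + Complex.I) ^ k * ((r - x * Complex.I) *
      (1 + l * Complex.I))).im) ∂(ghsMeasure r l) = 0 := fun k => by
    rw [hI, integral_ghsKernel_mul_im hr, mul_zero]
  have hpoly := integral_poly_four (X := fun x : ℝ => x) (ν := ghsMeasure r l)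
    aestronglyMeasurable_id h4
  -- the shift identities for `k = 0, 1, 2, 3` determine the first four moments successively
  have q0 : ∫ x : ℝ, x ∂(ghsMeasure r l) = r * l := by
    have h1 := hpoly (r * l) (-1) 0 0 0
    have h2 := hQ 0
    rw [integral_congr_ae (ae_of_all _ fun x => ?_), h2] at h1
    · linarith
    · simp
  have q1 : ∫ x : ℝ, x ^ 2 ∂(ghsMeasure r l) = r + (l + r * l) * (r * l) := by
    have h1 := hpoly r (l + r * l) (-1) 0 0
    have h2 := hQ 1
    rw [integral_congr_ae (ae_of_all _ fun x => ?_), h2, q0] at h1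
    · linarith
    · simp
      ring
  have q2 : ∫ x : ℝ, x ^ 3 ∂(ghsMeasure r l) =
      -(r * l) + (1 + 2 * r) * (r * l) + (r * l + 2 * l) * (r + (l + r * l) * (r * l)) := by
    have h1 := hpoly (-(r * l)) (1 + 2 * r) (r * l + 2 * l) (-1) 0
    have h2 := hQ 2
    rw [integral_congr_ae (ae_of_all _ fun x => ?_), h2, q0, q1] at h1
    · linarith
    · simp [pow_succ]
      ring
  have q3 := hpoly (-r) (-3 * r * l - l) (3 + 3 * r) (r * l + 3 * l) (-1)
  rw [integral_congr_ae (ae_of_all _ fun x => ?_), hQ 3, q0, q1, q2] at q3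
  swap
  · simp [pow_succ]
    ring
  have hV : α * (1 + l ^ 2) = α + 0 * (α * l) + 1 / α * (α * l) ^ 2 := by field_simp; ring
  have hW : 2 * l = 0 + 2 * (1 / α) * (α * l) := by field_simp; ring
  subst hrdef
  refine hasQVFMoments_of_raw (X := fun x : ℝ => x) measurable_id hτ.ne' hlaw h4 hV hW
    (q0.trans ?_) (q1.trans ?_) (q2.trans ?_)
    ?_
  · ring
  · ring
  · ring
  · field_simp
    linear_combination q3

/-! ### The five families -/

lemma exists_forall_sum_one_add_le {g : ℕ → ℝ} (hg : ∀ i, 0 ≤ g i)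
    (h : (fun p : ℕ => ∑ i ∈ Finset.range p, g i) =O[atTop] fun p : ℕ => (p : ℝ)) :
    ∃ C : ℝ, ∀ p : ℕ, ∑ i ∈ Finset.range p, (1 + g i) ≤ C * p := by
  obtain ⟨C, hC⟩ := exists_forall_sum_le hg h
  refine ⟨1 + C, fun p => ?_⟩
  rw [Finset.sum_add_distrib, Finset.sum_const, Finset.card_range, nsmul_eq_mul, mul_one]
  linarith [hC p]

lemma abs_pow_le_one_add_pow_four (x : ℝ) {k : ℕ} (hk : k ≤ 4) : |x| ^ k ≤ 1 + x ^ 4 := by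
  rw [← Even.pow_abs (by decide : Even 4) x]
  have h0 := abs_nonneg x
  rcases le_total |x| 1 with h | h
  · linarith [pow_le_one₀ (n := k) h0 h, pow_nonneg h0 4]
  · linarith [pow_le_pow_right₀ h hk]

theorem exists_momentBounds_of_model {Ω : Type*} [MeasurableSpace Ω] {P : Measure Ω}
    [IsProbabilityMeasure P] {Y : ℕ → Ω → ℝ} {ν₀ ν₁ ν₂ : ℝ} {τ θ : ℕ → ℝ}
    (h : NEFQVFModel P Y ν₀ ν₁ ν₂ τ θ) : ∃ C, MomentBounds P Y ν₀ ν₁ ν₂ τ θ C := by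
  cases h with
  | binomial n q law hn =>
    have hm := fun i => binomial_moments (lt_of_lt_of_le two_pos (hn i)) (law i)
    have hn2 : ∀ i, (2 : ℝ) ≤ n i := fun i => by exact_mod_cast hn i
    have hq0 : ∀ i, 0 ≤ (q i : ℝ) := fun i => (q i).2.1
    have hq1 : ∀ i, (q i : ℝ) ≤ 1 := fun i => (q i).2.2
    have hV0 : ∀ i, 0 ≤ (q i : ℝ) - (q i : ℝ) ^ 2 := fun i => by nlinarith [hq0 i, hq1 i]
    have hV1 : ∀ i, (q i : ℝ) - (q i : ℝ) ^ 2 ≤ 1 := fun i => by nlinarith [hq0 i, hq1 i]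
    have hVe : ∀ i, 0 + 1 * (q i : ℝ) + -1 * (q i : ℝ) ^ 2 = q i - (q i : ℝ) ^ 2 := fun i => by
      ring
    refine exists_momentBounds (K := 2) (g := fun _ => 1) (C := 1) two_pos two_pos.le hn2
      (fun i => by linarith [hn2 i]) (fun i => (hm i).1) (fun i => (hm i).2.1) (fun i => ?_)
      (fun i => (hm i).2.2.2.trans (by norm_num)) (fun i => ?_) (fun i => ?_) (fun i => ?_)
      (fun i => ?_) (fun p => by simp)
    · rw [hVe, (hm i).2.2.1]
    · rw [hVe]
      nlinarith [hV0 i, hV1 i, hq0 i, hq1 i]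
    · rw [hVe]
      nlinarith [hV0 i, hV1 i]
    · rw [hVe]
      have h1 : (1 + 2 * (-1) * (q i : ℝ)) ^ 2 ≤ 1 := by nlinarith [hq0 i, hq1 i]
      nlinarith [hV0 i, hV1 i, mul_le_mul_of_nonneg_right h1 (hV0 i)]
    · rw [abs_of_nonneg (hq0 i)]
      linarith [pow_le_one₀ (n := 3) (hq0 i) (hq1 i)]
  | poisson τ θ law hτ hτθ hθ =>
    obtain ⟨c, hc, hcτ⟩ := hτ
    obtain ⟨d, hd, hdτ⟩ := hτθ
    have hτ0 : ∀ i, 0 < τ i := fun i => hc.trans_le (hcτ i)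
    have hτθ0 : ∀ i, 0 < τ i * θ i := fun i => hd.trans_le (hdτ i)
    have hθ0 : ∀ i, 0 < θ i := fun i => (pos_iff_pos_of_mul_pos (hτθ0 i)).1 (hτ0 i)
    obtain ⟨C, hC⟩ := exists_forall_sum_one_add_le (fun i => pow_nonneg (hθ0 i).le 3) hθ
    have hb1 : ∀ i, θ i ≤ 1 + θ i ^ 3 := fun i => by
      nlinarith [hθ0 i, mul_nonneg (hθ0 i).le (sq_nonneg (θ i - 1)), sq_nonneg (θ i - 1)]
    have hb2 : ∀ i, θ i ^ 2 ≤ 1 + θ i ^ 3 := fun i => by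
      nlinarith [hθ0 i, mul_nonneg (hθ0 i).le (sq_nonneg (θ i - 1)), sq_nonneg (θ i - 1)]
    refine exists_momentBounds_of_hasQVFMoments (K := 2) (g := fun i => 1 + θ i ^ 3) hc two_pos.le
      le_rfl hcτ (fun i => hasQVFMoments_poisson (hτ0 i) (hτθ0 i) (law i))
      (fun i => ?_) (fun i => ?_) (fun i => ?_) (fun i => ?_) hC
    · nlinarith [hb1 i]
    · nlinarith [hb2 i, pow_pos (hθ0 i) 3]
    · nlinarith [hb1 i, pow_pos (hθ0 i) 3]
    · rw [abs_of_pos (hθ0 i)]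
      nlinarith [pow_pos (hθ0 i) 3]
  | negBinomial _ q n_pos q_mem law hnq hq =>
    obtain ⟨c, hc, hcn⟩ := hnq
    have hcn' : ∀ i, c ≤ τ i := fun i =>
      (hcn i).trans (mul_le_of_le_one_right (n_pos i).le (q_mem i).2.le)
    obtain ⟨C, hC⟩ := exists_forall_sum_one_add_le
      (fun i => (by positivity : 0 ≤ (q i / (1 - q i)) ^ 4)) hq
    have hθ0 : ∀ i, 0 ≤ q i / (1 - q i) := fun i =>
      div_nonneg (q_mem i).1.le (by linarith [(q_mem i).2])
    refine exists_momentBounds_of_hasQVFMoments (K := 20)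
      (g := fun i => 1 + (q i / (1 - q i)) ^ 4) hc (by norm_num)
      zero_le_one hcn' (fun i => hasQVFMoments_negBinomial (n_pos i) (q_mem i) (law i))
      (fun i => ?_) (fun i => ?_) (fun i => ?_) (fun i => ?_) hC
    all_goals
      have h0 := hθ0 i
      have h1 := abs_pow_le_one_add_pow_four (q i / (1 - q i)) (show 1 ≤ 4 by norm_num)
      have h2 := abs_pow_le_one_add_pow_four (q i / (1 - q i)) (show 2 ≤ 4 by norm_num)
      have h3 := abs_pow_le_one_add_pow_four (q i / (1 - q i)) (show 3 ≤ 4 by norm_num)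
      have h4 := abs_pow_le_one_add_pow_four (q i / (1 - q i)) (show 4 ≤ 4 by norm_num)
      rw [abs_of_nonneg h0] at h1 h2 h3 h4
    · nlinarith
    · nlinarith
    · nlinarith
    · rw [abs_of_nonneg h0]
      nlinarith [pow_nonneg h0 4]
  | gamma α τ l α_pos l_pos law hτ hl =>
    obtain ⟨c, hc, hcτ⟩ := hτ
    obtain ⟨C, hC⟩ := exists_forall_sum_one_add_le
      (fun i => (by positivity : 0 ≤ l i ^ 4)) hl
    refine exists_momentBounds_of_hasQVFMoments (K := α + α ^ 3 + α ^ 2 + 4 * α)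
      (g := fun i => 1 + l i ^ 4) hc (by positivity)
      (by positivity) hcτ
      (fun i => hasQVFMoments_gamma α_pos (hc.trans_le (hcτ i)) (l_pos i) (law i))
      (fun i => ?_) (fun i => ?_) (fun i => ?_) (fun i => ?_) hC
    all_goals
      have h2 := abs_pow_le_one_add_pow_four (l i) (show 2 ≤ 4 by norm_num)
      have h3 := abs_pow_le_one_add_pow_four (l i) (show 3 ≤ 4 by norm_num)
      have h4 : 0 ≤ l i ^ 4 := by positivity
      have hV : 0 + 0 * (α * l i) + 1 / α * (α * l i) ^ 2 = α * l i ^ 2 := by field_simp; ring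
      rw [sq_abs] at h2
      have p2 : 0 < α ^ 2 := by positivity
      have p3 : 0 < α ^ 3 := by positivity
    · rw [hV]
      nlinarith
    · rw [hV]
      nlinarith
    · have hW : 0 + 2 * (1 / α) * (α * l i) = 2 * l i := by field_simp; ring
      rw [hV, hW]
      nlinarith
    · rw [abs_mul, mul_pow, abs_of_pos α_pos]
      nlinarith
  | ghs _ τ l hν₀ law hτ hl =>
    obtain ⟨c, hc, hcτ⟩ := hτ
    obtain ⟨C, hC⟩ := exists_forall_sum_one_add_le
      (fun i => (by positivity : 0 ≤ l i ^ 4)) hl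
    refine exists_momentBounds_of_hasQVFMoments (K := 3 * (ν₀ + ν₀ ^ 3 + ν₀ ^ 2 + 4 * ν₀))
      (g := fun i => 1 + l i ^ 4) hc (by positivity)
      (by positivity) hcτ
      (fun i => hasQVFMoments_ghs hν₀ (hc.trans_le (hcτ i)) (law i))
      (fun i => ?_) (fun i => ?_) (fun i => ?_) (fun i => ?_) hC
    all_goals
      have h2 := abs_pow_le_one_add_pow_four (l i) (show 2 ≤ 4 by norm_num)
      have h3 := abs_pow_le_one_add_pow_four (l i) (show 3 ≤ 4 by norm_num)
      have h4 : 0 ≤ l i ^ 4 := by positivity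
      have hV : ν₀ + 0 * (ν₀ * l i) + 1 / ν₀ * (ν₀ * l i) ^ 2 = ν₀ * (1 + l i ^ 2) := by
        field_simp; ring
      rw [sq_abs] at h2
      have p2 : 0 < ν₀ ^ 2 := by positivity
      have p3 : 0 < ν₀ ^ 3 := by positivity
    · rw [hV]
      nlinarith
    · rw [hV]
      nlinarith
    · have hW : 0 + 2 * (1 / ν₀) * (ν₀ * l i) = 2 * l i := by field_simp; ring
      rw [hV, hW]
      nlinarith
    · rw [abs_mul, mul_pow, abs_of_pos hν₀]
      nlinarith

/-- For independent observations from a non-Gaussian natural exponential family with quadratic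
variance function, under the growth conditions of the respective family, `URE^P(γ, μ)` is uniformly
close to the loss of the conjugate-form estimator, in `L¹` and in probability. The set `Θ` to which
the location `μ` is restricted is arbitrary: it can be the mean-parameter space or all of `ℝ`. -/
theorem theorem5 {Ω : Type*} [MeasurableSpace Ω] (P : Measure Ω) [IsProbabilityMeasure P]
    (Y : ℕ → Ω → ℝ) (ν₀ ν₁ ν₂ : ℝ) (τ θ : ℕ → ℝ)
    (hmodel : NEFQVFModel P Y ν₀ ν₁ ν₂ τ θ) (hindep : iIndepFun Y P) (Θ : Set ℝ) :
    (∀ p : ℕ, AEMeasurable (fun ω => supDiscrepancy ν₀ ν₁ ν₂ τ θ Θ p (fun i => Y i ω)) P ∧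
      ∫⁻ ω, supDiscrepancy ν₀ ν₁ ν₂ τ θ Θ p (fun i => Y i ω) ∂P ≠ ∞) ∧
    Tendsto (fun p : ℕ => ∫⁻ ω, supDiscrepancy ν₀ ν₁ ν₂ τ θ Θ p (fun i => Y i ω) ∂P)
      atTop (𝓝 0) ∧
    ∀ ε : ℝ, 0 < ε →
      Tendsto (fun p : ℕ =>
        P {ω | ENNReal.ofReal ε ≤ supDiscrepancy ν₀ ν₁ ν₂ τ θ Θ p (fun i => Y i ω)})
        atTop (𝓝 0) := by
  obtain ⟨C, hC⟩ := exists_momentBounds_of_model hmodel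
  exact tendsto_supDiscrepancy hC hindep Θ
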